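/- Let $S^3$ be the Lie group of unit quaternions, with the usual smooth structure of the sphere. A metric on $S^3$ is a smooth field of nondegenerate symmetric bilinear forms on the tangent spaces (of any signature); it is left-invariant if all left translations are isometries. Two metrics are affinely equivalent if their Levi-Civita connections coincide; $\bar g$ is geodesically equivalent to $g$ if every geodesic of $g$ is a reparametrized geodesic of $\bar g$. A left-invariant metric $g$ is invariantly rigid if the left-invariant metrics affinely equivalent to $g$ are exactly the metrics $\lambda g$ with a real constant $\lambda\neq 0$. Theorem 3. Every left-invariant metric $g$ on $S^3$, of any signature, is invariantly rigid. Moreover, a left-invariant metric $\bar g$ on $S^3$ is geodesically equivalent to $g$ if and only if $\bar g=\lambda g$ for some real constant $\lambda\neq 0$. -/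

import Mathlib

open scoped Manifold ContDiff Quaternion

noncomputable section

/-- A smooth pseudo-Riemannian metric (of arbitrary signature) on a smooth manifold `M` modelled on
the vector space `E`: a smooth field of nondegenerate symmetric bilinear forms on the tangent
spaces. -/
structure PseudoRiemannianMetric (E : Type*) [NormedAddCommGroup E] [NormedSpace ℝ E]
    (M : Type*) [TopologicalSpace M] [ChartedSpace E M] [IsManifold 𝓘(ℝ, E) ∞ M] where
  /-- The bilinear form on the tangent space at `x`. -/
  val (x : M) : TangentSpace 𝓘(ℝ, E) x →L[ℝ] TangentSpace 𝓘(ℝ, E) x →L[ℝ] ℝ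
  symm (x : M) (v w : TangentSpace 𝓘(ℝ, E) x) : val x v w = val x w v
  nondegenerate (x : M) (v : TangentSpace 𝓘(ℝ, E) x) (hv : ∀ w, val x v w = 0) : v = 0
  contMDiff : ContMDiff 𝓘(ℝ, E) (𝓘(ℝ, E).prod 𝓘(ℝ, E →L[ℝ] E →L[ℝ] ℝ)) ∞
    (fun x ↦ Bundle.TotalSpace.mk' (E →L[ℝ] E →L[ℝ] ℝ)
      (E := fun x : M ↦ TangentSpace 𝓘(ℝ, E) x →L[ℝ] TangentSpace 𝓘(ℝ, E) x →L[ℝ] ℝ) x (val x))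

namespace PseudoRiemannianMetric

section Manifold

variable {E : Type*} [NormedAddCommGroup E] [NormedSpace ℝ E] [FiniteDimensional ℝ E]
  {M : Type*} [TopologicalSpace M] [ChartedSpace E M] [IsManifold 𝓘(ℝ, E) ∞ M]

/-- `cov` is a Levi-Civita connection of `g`: it is torsion-free and `g` is parallel, i.e.
`v (g(Y, Z)) = g(∇_v Y, Z) + g(Y, ∇_v Z)`. (`cov Y x v` is `∇_v Y` at `x`. Such a connection exists
and is unique on differentiable vector fields.) -/
def IsLeviCivita (g : PseudoRiemannianMetric E M)
    (cov : CovariantDerivative 𝓘(ℝ, E) E (TangentSpace 𝓘(ℝ, E) : M → Type _)) : Prop :=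
  haveI : CompleteSpace E := FiniteDimensional.complete ℝ E
  haveI : IsManifold 𝓘(ℝ, E) 2 M := inferInstance
  cov.torsion = 0 ∧
    ∀ (Y Z : ∀ x : M, TangentSpace 𝓘(ℝ, E) x) (x : M),
      MDiffAt (T% Y) x → MDiffAt (T% Z) x → ∀ v : TangentSpace 𝓘(ℝ, E) x,
        d% (fun y ↦ g.val y (Y y) (Z y)) x v =
          g.val x (cov Y x v) (Z x) + g.val x (Y x) (cov Z x v)

/-- Two metrics are affinely equivalent if their Levi-Civita connections coincide. -/
def AffinelyEquivalent (g g' : PseudoRiemannianMetric E M) : Prop :=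
  ∃ cov, g.IsLeviCivita cov ∧ g'.IsLeviCivita cov

end Manifold

end PseudoRiemannianMetric

section Geodesics

variable {E : Type*} [NormedAddCommGroup E] [NormedSpace ℝ E]
  {M : Type*} [TopologicalSpace M] [ChartedSpace E M] [IsManifold 𝓘(ℝ, E) ∞ M]

/-- The velocity `γ'(t)` of a curve in `M`. -/
def curveVelocity (γ : ℝ → M) (t : ℝ) : TangentSpace 𝓘(ℝ, E) (γ t) :=
  mfderiv 𝓘(ℝ) 𝓘(ℝ, E) γ t (1 : ℝ)

/-- The vector field near `p` with constant coefficients `v` in the preferred chart at `p`, i.e.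
`v^i ∂_i` in these coordinates. (It is `0` outside the chart; its value at `p` is `v`.) -/
def coordinateField (p : M) (v : E) (x : M) : TangentSpace 𝓘(ℝ, E) x :=
  (trivializationAt E (TangentSpace 𝓘(ℝ, E) : M → Type _) p).symmL ℝ x v

/-- The covariant acceleration `∇_{γ'} γ'` of a curve at time `t`, written in the coordinates
`φ` of the preferred chart at `γ t`: it is `(φ ∘ γ)''(t) + ∇_{v} V`, where `v = γ'(t)` and `V` is
the vector field which extends `v` with constant coefficients in these coordinates, i.e.
`(γ^i)'' + Γ^i_{jk} (γ^j)' (γ^k)'`. -/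
def covariantAcceleration
    (cov : CovariantDerivative 𝓘(ℝ, E) E (TangentSpace 𝓘(ℝ, E) : M → Type _))
    (γ : ℝ → M) (t : ℝ) : TangentSpace 𝓘(ℝ, E) (γ t) :=
  let a : TangentSpace 𝓘(ℝ, E) (γ t) := deriv (deriv (extChartAt 𝓘(ℝ, E) (γ t) ∘ γ)) t
  a + cov (coordinateField (γ t) (curveVelocity γ t)) (γ t) (curveVelocity γ t)

end Geodesics

namespace PseudoRiemannianMetric

section Manifold

variable {E : Type*} [NormedAddCommGroup E] [NormedSpace ℝ E] [FiniteDimensional ℝ E]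
  {M : Type*} [TopologicalSpace M] [ChartedSpace E M] [IsManifold 𝓘(ℝ, E) ∞ M]

/-- `γ` is a (parametrized) geodesic of `g` on the open interval `J`: it is smooth there and
`∇_{γ'} γ' = 0` for the Levi-Civita connection of `g`. -/
def IsGeodesicOn (g : PseudoRiemannianMetric E M) (γ : ℝ → M) (J : Set ℝ) : Prop :=
  IsOpen J ∧ J.OrdConnected ∧ ContMDiffOn 𝓘(ℝ) 𝓘(ℝ, E) ∞ γ J ∧
    ∃ cov, g.IsLeviCivita cov ∧ ∀ t ∈ J, covariantAcceleration cov γ t = 0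

/-- `g'` is geodesically equivalent to `g` if every geodesic `γ` of `g` is a reparametrized geodesic
`γ' ∘ τ` of `g'`, with a smooth change of parameter `τ` without critical points. -/
def GeodesicallyEquivalent (g g' : PseudoRiemannianMetric E M) : Prop :=
  ∀ (γ : ℝ → M) (J : Set ℝ), g.IsGeodesicOn γ J →
    ∃ (γ' : ℝ → M) (J' : Set ℝ) (τ : ℝ → ℝ), g'.IsGeodesicOn γ' J' ∧
      ContDiffOn ℝ ∞ τ J ∧ (∀ t ∈ J, deriv τ t ≠ 0) ∧ τ '' J = J' ∧
      ∀ t ∈ J, γ t = γ' (τ t)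

/-- `g'` is a nonzero constant multiple of `g`. -/
def IsConstantMultiple (g g' : PseudoRiemannianMetric E M) : Prop :=
  ∃ c : ℝ, c ≠ 0 ∧ ∀ (x : M) (v w : TangentSpace 𝓘(ℝ, E) x), g'.val x v w = c * g.val x v w

end Manifold

section LieGroup

variable {E : Type*} [NormedAddCommGroup E] [NormedSpace ℝ E] [FiniteDimensional ℝ E]
  {G : Type*} [TopologicalSpace G] [ChartedSpace E G] [Group G] [LieGroup 𝓘(ℝ, E) ∞ G]

/-- A metric on a Lie group is left-invariant if all left translations are isometries. -/
def IsLeftInvariant (g : PseudoRiemannianMetric E G) : Prop :=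
  ∀ (a x : G) (v w : TangentSpace 𝓘(ℝ, E) x),
    g.val (a * x) (mfderiv 𝓘(ℝ, E) 𝓘(ℝ, E) (fun y ↦ a * y) x v)
      (mfderiv 𝓘(ℝ, E) 𝓘(ℝ, E) (fun y ↦ a * y) x w) = g.val x v w

/-- A (left-invariant) metric on a Lie group is invariantly rigid if the left-invariant metrics that
are affinely equivalent to it are exactly its nonzero constant multiples. -/
def IsInvariantlyRigid (g : PseudoRiemannianMetric E G) : Prop :=
  ∀ g' : PseudoRiemannianMetric E G, g'.IsLeftInvariant →
    (g.AffinelyEquivalent g' ↔ g.IsConstantMultiple g')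

end LieGroup

end PseudoRiemannianMetric

/-- The three-dimensional sphere, as the group of unit quaternions. -/
abbrev QuaternionSphere : Type := Metric.sphere (0 : ℍ[ℝ]) 1

instance fact_finrank_quaternion : Fact (Module.finrank ℝ ℍ[ℝ] = 3 + 1) :=
  ⟨Quaternion.finrank_eq_four⟩

/-- The unit quaternions form a Lie group, for the usual smooth structure of the sphere. -/
instance lieGroup_quaternionSphere : LieGroup (𝓡 3) ∞ QuaternionSphere where
  contMDiff_mul := by
    apply ContMDiff.codRestrict_sphere
    let c : QuaternionSphere → ℍ[ℝ] := (↑)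
    have h₂ : ContMDiff (𝓘(ℝ, ℍ[ℝ]).prod 𝓘(ℝ, ℍ[ℝ])) 𝓘(ℝ, ℍ[ℝ]) ∞
        fun z : ℍ[ℝ] × ℍ[ℝ] ↦ z.fst * z.snd := by
      rw [contMDiff_iff]
      exact ⟨continuous_mul, fun x y ↦ contDiff_mul.contDiffOn⟩
    have h₁ : ContMDiff ((𝓡 3).prod (𝓡 3)) (𝓘(ℝ, ℍ[ℝ]).prod 𝓘(ℝ, ℍ[ℝ])) ∞ (Prod.map c c) := by
      have hc : ContMDiff (𝓡 3) 𝓘(ℝ, ℍ[ℝ]) ∞ c := contMDiff_coe_sphere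
      exact hc.prodMap hc
    exact h₂.comp h₁
  contMDiff_inv := by
    apply ContMDiff.codRestrict_sphere
    have hs : ContDiff ℝ ∞ (fun q : ℍ[ℝ] ↦ star q) :=
      (LinearMap.toContinuousLinearMap
        { toFun := fun q : ℍ[ℝ] ↦ star q
          map_add' := star_add
          map_smul' := fun r q ↦ Quaternion.star_smul r q }).contDiff
    have hc : ContMDiff (𝓡 3) 𝓘(ℝ, ℍ[ℝ]) ∞ ((↑) : QuaternionSphere → ℍ[ℝ]) :=
      contMDiff_coe_sphere
    refine (hs.contMDiff.comp hc).congr fun x ↦ ?_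
    have hx : Quaternion.normSq (x : ℍ[ℝ]) = 1 := by
      rw [Quaternion.normSq_eq_norm_mul_self, mem_sphere_zero_iff_norm.1 x.2, mul_one]
    simp [Quaternion.inv_def, hx]

end

/-! Left translation identifies every tangent space of `S³` with the imaginary quaternions, so a
left-invariant metric becomes one nondegenerate symmetric form `β` on `ℝ³`. For its Levi-Civita
connection and the left-invariant field of `u`, the vector `q(u) = ∇_u u` is determined by `β(q(u),
w) = β(u, [w, u])`. A curve with body velocity `u(t)` is a geodesic exactly when Euler's equation
`u' = -q(u)` holds (`IsLeftInvariant.hasDerivAt_bodyVelocity`).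

If two metrics share their connection, then `q = q'`. If geodesics of `g` are reparametrized
geodesics of `g'`, differentiating `u(t) = τ'(t) u'(τ(t))` shows that `q(u) - q'(u)` is a multiple
of `u`; since a geodesic starts with any given velocity, this holds for all `u`. Both cases thus
reduce to one algebraic statement, `exists_eq_smul_of_quadratic_parallel`.

For that statement, choose a Euclidean orthonormal basis that diagonalizes `β`. The bracket is twice
the cross product, so the basis keeps cyclic brackets `[b 0, b 1] = s b 2`, whatever the signature
of `β`. Each basis vector is a zero of `q`, hence an eigendirection of `q'`, and this forces `β'` to
be diagonal in the same basis. Comparing `q` and `q'` on the sums `b i + b j` gives three relations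
between the diagonal entries, which make them proportional.

Conversely, a constant factor cancels from the equation of metric compatibility, so the connection
and the geodesics do not change. -/

noncomputable section

/-! ### The algebraic rigidity statement -/

/-- Let `[b 0, b 1] = s b 2` and cyclically, let `β` be a nondegenerate form which is diagonal in
the basis `b`, and let `q`, `q'` be the quadratic vector fields determined by
`β (q u) w = β u [w, u]`. If `q u - q' u` is always a multiple of `u` then `β'` is a multiple
of `β`. -/
lemma exists_eq_smul_of_quadratic_parallel {V : Type*} [AddCommGroup V] [Module ℝ V]
    (b : Module.Basis (Fin 3) ℝ V) (br : V →ₗ[ℝ] V →ₗ[ℝ] V) (hbr : ∀ u, br u u = 0)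
    {s : ℝ} (hs : s ≠ 0) (h01 : br (b 0) (b 1) = s • b 2) (h12 : br (b 1) (b 2) = s • b 0)
    (h20 : br (b 2) (b 0) = s • b 1)
    (β β' : V →ₗ[ℝ] V →ₗ[ℝ] ℝ)
    (hβ : ∀ u, (∀ w, β u w = 0) → u = 0) (hβ' : ∀ u, (∀ w, β' u w = 0) → u = 0)
    (hd : ∀ i j, i ≠ j → β (b i) (b j) = 0) (q q' : V → V)
    (hq : ∀ u w, β (q u) w = β u (br w u)) (hq' : ∀ u w, β' (q' u) w = β' u (br w u))
    (hqq : ∀ u, ∃ r : ℝ, q u = q' u + r • u) :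
    ∃ c : ℝ, c ≠ 0 ∧ ∀ u w, β' u w = c * β u w := by
  have hanti (u w) : br u w = - br w u := by
    have := hbr (u + w)
    simp only [map_add, LinearMap.add_apply, hbr, zero_add, add_zero] at this
    exact eq_neg_of_add_eq_zero_right this
  have h10 : br (b 1) (b 0) = -(s • b 2) := by rw [hanti, h01]
  have h21 : br (b 2) (b 1) = -(s • b 0) := by rw [hanti, h12]
  have h02 : br (b 0) (b 2) = -(s • b 1) := by rw [hanti, h20]
  have d01 := hd 0 1 (by decide)
  have d02 := hd 0 2 (by decide)
  have d10 := hd 1 0 (by decide)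
  have d12 := hd 1 2 (by decide)
  have d20 := hd 2 0 (by decide)
  have d21 := hd 2 1 (by decide)
  have hext (β : V →ₗ[ℝ] V →ₗ[ℝ] ℝ) (hβ : ∀ u, (∀ w, β u w = 0) → u = 0) (u : V)
      (h0 : β u (b 0) = 0) (h1 : β u (b 1) = 0) (h2 : β u (b 2) = 0) : u = 0 := by
    refine hβ u fun w ↦ ?_
    have : β u = 0 := b.ext fun i ↦ by fin_cases i <;> simpa
    simp [this]
  -- As `q (b i) = 0`, the vector `q' (b i)` is `-r • b i`. Pairing it with `b j` and `b k` gives a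
  -- homogeneous linear system for the two off-diagonal entries, with determinant `s ^ 2 + r ^ 2 ≠
  -- 0`.
  have key (i j k : Fin 3) (hij : br (b i) (b j) = s • b k)
      (hki : br (b k) (b i) = s • b j) (hq0 : q (b i) = 0) :
      β' (b i) (b j) = 0 ∧ β' (b i) (b k) = 0 := by
    obtain ⟨r, hr⟩ := hqq (b i)
    rw [hq0] at hr
    have hq1 : q' (b i) = -(r • b i) := eq_neg_of_add_eq_zero_left hr.symm
    have e1 := hq' (b i) (b j)
    have e2 := hq' (b i) (b k)
    rw [hq1, hanti, hij] at e1
    rw [hq1, hki] at e2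
    simp only [map_neg, map_smul, LinearMap.neg_apply, LinearMap.smul_apply, smul_eq_mul] at e1 e2
    have hpos : s ^ 2 + r ^ 2 ≠ 0 := by positivity
    constructor
    · refine (mul_eq_zero.1 (?_ : (s ^ 2 + r ^ 2) * β' (b i) (b j) = 0)).resolve_left hpos
      linear_combination -s * e2 - r * e1
    · refine (mul_eq_zero.1 (?_ : (s ^ 2 + r ^ 2) * β' (b i) (b k) = 0)).resolve_left hpos
      linear_combination s * e1 - r * e2
  have q0 : q (b 0) = 0 := hext β hβ _ (by simp [hq, hbr]) (by simp [hq, h10, d02])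
    (by simp [hq, h20, d01])
  have q1 : q (b 1) = 0 := hext β hβ _ (by simp [hq, h01, d12]) (by simp [hq, hbr])
    (by simp [hq, h21, d10])
  have q2 : q (b 2) = 0 := hext β hβ _ (by simp [hq, h02, d21]) (by simp [hq, h12, d20])
    (by simp [hq, hbr])
  obtain ⟨e01, e02⟩ := key 0 1 2 h01 h20 q0
  obtain ⟨e12, e10⟩ := key 1 2 0 h12 h01 q1
  obtain ⟨e20, e21⟩ := key 2 0 1 h20 h12 q2
  have he (i j : Fin 3) (hij : i ≠ j) : β' (b i) (b j) = 0 := by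
    fin_cases i <;> fin_cases j <;> first | exact absurd rfl hij | assumption
  -- Both `q` and `q'` send `b i + b j` to a multiple of `b k`, and the correction `r • (b i + b j)`
  -- has no `b k` component. The two coefficients therefore agree.
  have key2 (i j k : Fin 3) (hij : br (b i) (b j) = s • b k) (hjk : br (b j) (b k) = s • b i)
      (hki : br (b k) (b i) = s • b j) (hne : i ≠ j ∧ j ≠ k ∧ k ≠ i) :
      β (b k) (b k) ≠ 0 ∧ β' (b k) (b k) * (β (b j) (b j) - β (b i) (b i)) =
        β (b k) (b k) * (β' (b j) (b j) - β' (b i) (b i)) := by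
    obtain ⟨nij, njk, nki⟩ := hne
    have hall (β : V →ₗ[ℝ] V →ₗ[ℝ] ℝ) (hβ : ∀ u, (∀ w, β u w = 0) → u = 0) (u : V)
        (hi : β u (b i) = 0) (hj : β u (b j) = 0) (hk : β u (b k) = 0) : u = 0 := by
      have h (l : Fin 3) : β u (b l) = 0 := by
        obtain rfl | rfl | rfl : l = i ∨ l = j ∨ l = k := by omega
        all_goals assumption
      exact hext β hβ u (h 0) (h 1) (h 2)
    have hkk (β : V →ₗ[ℝ] V →ₗ[ℝ] ℝ) (hβ : ∀ u, (∀ w, β u w = 0) → u = 0)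
        (hd : ∀ i j, i ≠ j → β (b i) (b j) = 0) : β (b k) (b k) ≠ 0 := fun h ↦
      b.ne_zero k (hall β hβ _ (hd k i nki) (hd k j njk.symm) h)
    have form (β : V →ₗ[ℝ] V →ₗ[ℝ] ℝ) (hβ : ∀ u, (∀ w, β u w = 0) → u = 0)
        (hd : ∀ i j, i ≠ j → β (b i) (b j) = 0) (q : V → V)
        (hq : ∀ u w, β (q u) w = β u (br w u)) :
        q (b i + b j) = (s * (β (b j) (b j) - β (b i) (b i)) / β (b k) (b k)) • b k := by
      have hk := hkk β hβ hd
      have hji : br (b j) (b i) = -(s • b k) := by rw [hanti, hij]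
      have hkj : br (b k) (b j) = -(s • b i) := by rw [hanti, hjk]
      rw [← sub_eq_zero]
      refine hall β hβ _ ?_ ?_ ?_
      · simp [hq, hbr, hij, hd i k nki.symm, hd j k njk, hd k i nki]
      · simp [hq, hbr, hji, hd i k nki.symm, hd j k njk, hd k j njk.symm]
      · simp [hq, hki, hkj, hd i j nij, hd j i nij.symm]
        field_simp
        ring
    have hk := hkk β hβ hd
    have hk' := hkk β' hβ' he
    refine ⟨hk, ?_⟩
    obtain ⟨r, hr⟩ := hqq (b i + b j)
    rw [form β hβ hd q hq, form β' hβ' he q' hq'] at hr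
    have h2 := congrArg (fun v ↦ β v (b k)) hr
    simp only [map_add, map_smul, LinearMap.add_apply, LinearMap.smul_apply, smul_eq_mul,
      hd i k nki.symm, hd j k njk, add_zero, mul_zero] at h2
    have h3 := mul_right_cancel₀ hk h2
    rw [div_eq_div_iff hk hk'] at h3
    refine mul_left_cancel₀ hs ?_
    linear_combination h3
  obtain ⟨n2, k2⟩ := key2 0 1 2 h01 h12 h20 (by decide)
  obtain ⟨n0, k0⟩ := key2 1 2 0 h12 h20 h01 (by decide)
  obtain ⟨n1, k1⟩ := key2 2 0 1 h20 h01 h12 (by decide)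
  -- With `m i j = β i * β' j - β j * β' i` on diagonal entries, `k2`, `k0`, `k1` say `m 1 2 = m 0
  -- 2`, `m 0 1 = m 0 2` and `m 0 1 = -m 1 2`, so all three vanish.
  have r01 : β (b 0) (b 0) * β' (b 1) (b 1) = β (b 1) (b 1) * β' (b 0) (b 0) := by linarith
  have r02 : β (b 0) (b 0) * β' (b 2) (b 2) = β (b 2) (b 2) * β' (b 0) (b 0) := by linarith
  refine ⟨β' (b 0) (b 0) / β (b 0) (b 0), div_ne_zero (fun h ↦ b.ne_zero 0 ?_) n0, ?_⟩
  · exact hext β' hβ' _ h (he 0 1 (by decide)) (he 0 2 (by decide))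
  · have : β' = (β' (b 0) (b 0) / β (b 0) (b 0)) • β := by
      refine b.ext fun i ↦ b.ext fun j ↦ ?_
      by_cases hij : i = j
      · subst hij
        simp only [LinearMap.smul_apply, smul_eq_mul]
        rw [div_mul_eq_mul_div, eq_div_iff n0]
        fin_cases i <;> simp <;> linarith
      · simp [hd i j hij, he i j hij]
    intro u w
    conv_lhs => rw [this]
    simp

/-! ### Imaginary quaternions as a Lie algebra, and the Koszul formula -/

/-- The embedding of `ℝ³` in the quaternions as the space of imaginary quaternions. -/
def imQuaternion : EuclideanSpace ℝ (Fin 3) →L[ℝ] ℍ[ℝ] :=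
  LinearMap.toContinuousLinearMap
    { toFun := fun v ↦ ⟨0, v 0, v 1, v 2⟩
      map_add' := fun _ _ ↦ Quaternion.ext _ _ (add_zero 0).symm rfl rfl rfl
      map_smul' := fun r _ ↦ Quaternion.ext _ _ (mul_zero r).symm rfl rfl rfl }

/-- The imaginary part of a quaternion, as a vector in `ℝ³`. -/
def imVector : ℍ[ℝ] →L[ℝ] EuclideanSpace ℝ (Fin 3) :=
  LinearMap.toContinuousLinearMap
    { toFun := fun q ↦ !₂[q.imI, q.imJ, q.imK]
      map_add' := fun v w ↦ by ext i; fin_cases i <;> simp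
      map_smul' := fun r v ↦ by ext i; fin_cases i <;> simp }

@[simp] lemma imQuaternion_re (v : EuclideanSpace ℝ (Fin 3)) : (imQuaternion v).re = 0 := rfl

@[simp] lemma imQuaternion_imI (v : EuclideanSpace ℝ (Fin 3)) : (imQuaternion v).imI = v 0 := rfl

@[simp] lemma imQuaternion_imJ (v : EuclideanSpace ℝ (Fin 3)) : (imQuaternion v).imJ = v 1 := rfl

@[simp] lemma imQuaternion_imK (v : EuclideanSpace ℝ (Fin 3)) : (imQuaternion v).imK = v 2 := rfl

lemma imVector_apply (q : ℍ[ℝ]) : imVector q = !₂[q.imI, q.imJ, q.imK] := rfl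

@[simp] lemma imVector_imQuaternion (v : EuclideanSpace ℝ (Fin 3)) :
    imVector (imQuaternion v) = v := by
  ext i; fin_cases i <;> simp [imVector_apply]

lemma imQuaternion_imVector {q : ℍ[ℝ]} (hq : q.re = 0) : imQuaternion (imVector q) = q := by
  ext <;> simp [imVector_apply, hq]

/-- The Lie bracket of imaginary quaternions. -/
def imBracket : EuclideanSpace ℝ (Fin 3) →L[ℝ] EuclideanSpace ℝ (Fin 3) →L[ℝ]
    EuclideanSpace ℝ (Fin 3) :=
  let m := (ContinuousLinearMap.mul ℝ ℍ[ℝ]).bilinearComp imQuaternion imQuaternion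
  (ContinuousLinearMap.compL ℝ _ _ _ imVector).comp (m - m.flip)

lemma imBracket_apply (u w : EuclideanSpace ℝ (Fin 3)) :
    imBracket u w =
      imVector (imQuaternion u * imQuaternion w - imQuaternion w * imQuaternion u) := by
  simp [imBracket]

lemma imBracket_eq (u w : EuclideanSpace ℝ (Fin 3)) :
    imBracket u w = !₂[2 * (u 1 * w 2 - u 2 * w 1), 2 * (u 2 * w 0 - u 0 * w 2),
      2 * (u 0 * w 1 - u 1 * w 0)] := by
  rw [imBracket_apply]
  ext i
  fin_cases i <;> simp [imVector_apply] <;> ring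

@[simp] lemma imBracket_self (u : EuclideanSpace ℝ (Fin 3)) : imBracket u u = 0 := by
  simp [imBracket_apply]

lemma imBracket_swap (u w : EuclideanSpace ℝ (Fin 3)) : imBracket u w = -imBracket w u := by
  simp only [imBracket_apply, ← map_neg, neg_sub]

/-- Cyclic symmetry of the scalar triple product, the bracket being twice the cross product. -/
lemma inner_imBracket_rotate (u v w : EuclideanSpace ℝ (Fin 3)) :
    inner ℝ u (imBracket v w) = inner ℝ v (imBracket w u) := by
  simp only [imBracket_eq, PiLp.inner_apply, Fin.sum_univ_three]
  simp
  ring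

/-- By the cyclic symmetry of the triple product, `[u, w]` is orthogonal to `u` and `w`, and the
three remaining coefficients are equal. Their common value is nonzero because the bracket is not
identically zero. -/
lemma exists_bracket_eq_smul_orthonormalBasis
    (b : OrthonormalBasis (Fin 3) ℝ (EuclideanSpace ℝ (Fin 3))) :
    ∃ s : ℝ, s ≠ 0 ∧ imBracket (b 0) (b 1) = s • b 2 ∧ imBracket (b 1) (b 2) = s • b 0 ∧
      imBracket (b 2) (b 0) = s • b 1 := by
  set s := inner ℝ (b 2) (imBracket (b 0) (b 1)) with hs
  have hs0 : inner ℝ (b 0) (imBracket (b 1) (b 2)) = s := by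
    rw [hs, inner_imBracket_rotate (b 2)]
  have hs1 : inner ℝ (b 1) (imBracket (b 2) (b 0)) = s := by
    rw [← hs0, inner_imBracket_rotate (b 0)]
  have hl (u w : EuclideanSpace ℝ (Fin 3)) : inner ℝ u (imBracket u w) = 0 := by
    rw [inner_imBracket_rotate, inner_imBracket_rotate, imBracket_self, inner_zero_right]
  have hr (u w : EuclideanSpace ℝ (Fin 3)) : inner ℝ w (imBracket u w) = 0 := by
    rw [imBracket_swap, inner_neg_right, hl, neg_zero]
  have e2 : imBracket (b 0) (b 1) = s • b 2 := by
    rw [← b.sum_repr' (imBracket (b 0) (b 1)), Fin.sum_univ_three, hl, hr, ← hs]; simp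
  have e0 : imBracket (b 1) (b 2) = s • b 0 := by
    rw [← b.sum_repr' (imBracket (b 1) (b 2)), Fin.sum_univ_three, hl, hr, hs0]; simp
  have e1 : imBracket (b 2) (b 0) = s • b 1 := by
    rw [← b.sum_repr' (imBracket (b 2) (b 0)), Fin.sum_univ_three, hl, hr, hs1]; simp
  refine ⟨s, fun h0 ↦ ?_, e2, e0, e1⟩
  rw [h0, zero_smul] at e0 e1 e2
  have h : imBracket.toLinearMap₁₂ = 0 := by
    refine b.toBasis.ext fun i ↦ b.toBasis.ext fun j ↦ ?_
    fin_cases i <;> fin_cases j <;> simp [e0, e1, e2, imBracket_swap (b 1) (b 0),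
      imBracket_swap (b 0) (b 2), imBracket_swap (b 2) (b 1)]
  have h2 : imBracket (EuclideanSpace.single 0 1) (EuclideanSpace.single 1 1) = 0 := by
    simpa using congrArg (fun f ↦ f (EuclideanSpace.single 0 1) (EuclideanSpace.single 1 1)) h
  rw [imBracket_eq] at h2
  simpa using congrArg (fun v ↦ v 2) h2

/-- A symmetric bilinear form on Euclidean space is diagonal in an orthonormal basis. -/
lemma exists_orthonormalBasis_diagonal
    (β : EuclideanSpace ℝ (Fin 3) →L[ℝ] EuclideanSpace ℝ (Fin 3) →L[ℝ] ℝ)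
    (hβ : ∀ u w, β u w = β w u) :
    ∃ b : OrthonormalBasis (Fin 3) ℝ (EuclideanSpace ℝ (Fin 3)),
      ∀ i j, i ≠ j → β (b i) (b j) = 0 := by
  -- The self-adjoint operator that represents `β` in the Euclidean inner product; its eigenvectors
  -- give the basis.
  let T : EuclideanSpace ℝ (Fin 3) →ₗ[ℝ] EuclideanSpace ℝ (Fin 3) :=
    (InnerProductSpace.toDual ℝ (EuclideanSpace ℝ (Fin 3))).symm.toLinearEquiv.toLinearMap ∘ₗ
      β.toLinearMap
  have hT (u w) : inner ℝ (T u) w = β u w := by simp [T]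
  have hsymm : T.IsSymmetric := fun u w ↦ by
    rw [hT, real_inner_comm, hT, hβ]
  have hn : Module.finrank ℝ (EuclideanSpace ℝ (Fin 3)) = 3 := by simp
  refine ⟨hsymm.eigenvectorBasis hn, fun i j hij ↦ ?_⟩
  rw [← hT, hsymm.apply_eigenvectorBasis, inner_smul_left,
    (hsymm.eigenvectorBasis hn).inner_eq_zero hij, mul_zero]

lemma exists_eq_smul_of_imBracket_quadratic_parallel
    (β β' : EuclideanSpace ℝ (Fin 3) →L[ℝ] EuclideanSpace ℝ (Fin 3) →L[ℝ] ℝ)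
    (hβs : ∀ u w, β u w = β w u)
    (hβ : ∀ u, (∀ w, β u w = 0) → u = 0) (hβ' : ∀ u, (∀ w, β' u w = 0) → u = 0)
    (q q' : EuclideanSpace ℝ (Fin 3) → EuclideanSpace ℝ (Fin 3))
    (hq : ∀ u w, β (q u) w = β u (imBracket w u))
    (hq' : ∀ u w, β' (q' u) w = β' u (imBracket w u))
    (hqq : ∀ u, ∃ r : ℝ, q u = q' u + r • u) :
    ∃ c : ℝ, c ≠ 0 ∧ ∀ u w, β' u w = c * β u w := by
  obtain ⟨b, hb⟩ := exists_orthonormalBasis_diagonal β hβs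
  obtain ⟨s, hs, h01, h12, h20⟩ := exists_bracket_eq_smul_orthonormalBasis b
  exact exists_eq_smul_of_quadratic_parallel b.toBasis imBracket.toLinearMap₁₂ (by simp) hs
    (by simpa) (by simpa) (by simpa) β.toLinearMap₁₂ β'.toLinearMap₁₂ hβ hβ' (by simpa) q q'
    hq hq' hqq

/-- The Levi-Civita connection of a nondegenerate symmetric form on a Lie algebra. -/
lemma exists_koszul (β : EuclideanSpace ℝ (Fin 3) →L[ℝ] EuclideanSpace ℝ (Fin 3) →L[ℝ] ℝ)
    (hβs : ∀ u w, β u w = β w u) (hβ : ∀ u, (∀ w, β u w = 0) → u = 0) :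
    ∃ A : EuclideanSpace ℝ (Fin 3) →L[ℝ] EuclideanSpace ℝ (Fin 3) →L[ℝ] EuclideanSpace ℝ (Fin 3),
      (∀ u v, A u v - A v u = imBracket u v) ∧ (∀ u v w, β (A u v) w + β v (A u w) = 0) := by
  have hinj : Function.Injective (fun u ↦ β u) := fun u v h ↦ by
    rw [← sub_eq_zero]
    exact hβ _ fun w ↦ by
      have : β u = β v := h
      simp [this]
  let T : EuclideanSpace ℝ (Fin 3) →ₗ[ℝ] Module.Dual ℝ (EuclideanSpace ℝ (Fin 3)) :=
    β.toLinearMap₁₂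
  have hT : Function.Injective T := fun u v h ↦
    hinj (ContinuousLinearMap.ext fun w ↦ LinearMap.congr_fun h w)
  let R := LinearEquiv.ofInjectiveOfFinrankEq T hT Subspace.dual_finrank_eq.symm
  have hR (f w) : β (R.symm f) w = f w := LinearMap.congr_fun (R.apply_symm_apply f) w
  -- The right side of the Koszul formula for left-invariant fields, where derivatives of metric
  -- coefficients vanish. Nondegeneracy (`R`) turns this functional into the vector `∇_u v`.
  let K (u v : EuclideanSpace ℝ (Fin 3)) : Module.Dual ℝ (EuclideanSpace ℝ (Fin 3)) :=
    (1 / 2 : ℝ) • ((β (imBracket u v)).comp (ContinuousLinearMap.id ℝ _) -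
      (β u).comp (imBracket v) - (β v).comp (imBracket u) :
        EuclideanSpace ℝ (Fin 3) →L[ℝ] ℝ).toLinearMap
  have hK (u v w) : K u v w = 1 / 2 * (β (imBracket u v) w - β u (imBracket v w)
      - β v (imBracket u w)) := by simp [K]
  let A₀ := LinearMap.mk₂ ℝ (fun u v ↦ R.symm (K u v))
    (fun u u' v ↦ by
      rw [← map_add]; congr 1; ext w; simp only [hK, map_add, LinearMap.add_apply,
        add_apply]; ring)
    (fun r u v ↦ by
      rw [← map_smul]; congr 1; ext w; simp only [hK, map_smul, LinearMap.smul_apply,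
        smul_apply, smul_eq_mul]; ring)
    (fun u v v' ↦ by
      rw [← map_add]; congr 1; ext w; simp only [hK, map_add, LinearMap.add_apply,
        add_apply]; ring)
    (fun r u v ↦ by
      rw [← map_smul]; congr 1; ext w; simp only [hK, map_smul, LinearMap.smul_apply,
        smul_apply, smul_eq_mul]; ring)
  have hA (u v w) : β (A₀.toContinuousBilinearMap u v) w =
      1 / 2 * (β (imBracket u v) w - β u (imBracket v w) - β v (imBracket u w)) := by
    rw [← hK, ← hR]; rfl
  refine ⟨A₀.toContinuousBilinearMap, fun u v ↦ ?_, fun u v w ↦ ?_⟩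
  · refine hinj (ContinuousLinearMap.ext fun w ↦ ?_)
    simp only [map_sub, sub_apply, hA]
    rw [imBracket_swap v u]
    simp only [map_neg, neg_apply]
    ring
  · rw [hβs v, hA, hA, imBracket_swap w v, hβs (imBracket u v) w, hβs (imBracket u w) v]
    simp only [map_neg]
    ring

/-! ### Vector fields as derivations, computed in the preferred chart -/

section Bracket

open VectorField Filter
open scoped Topology

variable {E : Type*} [NormedAddCommGroup E] [NormedSpace ℝ E]
  {F : Type*} [NormedAddCommGroup F] [NormedSpace ℝ F]
  {M : Type*} [TopologicalSpace M] [ChartedSpace E M]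

/-- The tangent space at `x` is a copy of `E` through the preferred chart at `x`, so no change of
coordinates appears. -/
lemma mvfderiv_apply_eq_fderiv {f : M → F} {x : M} (hf : MDiffAt f x)
    (v : TangentSpace 𝓘(ℝ, E) x) :
    d% f x v = fderiv ℝ (f ∘ (extChartAt 𝓘(ℝ, E) x).symm) (extChartAt 𝓘(ℝ, E) x x) v := by
  rw [hf.mvfderiv, ModelWithCorners.range_eq_univ, fderivWithin_univ]
  rfl

lemma contDiffAt_comp_extChartAt_symm {f : M → F} (hf : ContMDiff 𝓘(ℝ, E) 𝓘(ℝ, F) ∞ f) (x : M) :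
    ContDiffAt ℝ ∞ (f ∘ (extChartAt 𝓘(ℝ, E) x).symm) (extChartAt 𝓘(ℝ, E) x x) := by
  have h := (contMDiffAt_iff.1 (hf x)).2
  rw [ModelWithCorners.range_eq_univ, contDiffWithinAt_univ] at h
  exact h

variable [IsManifold 𝓘(ℝ, E) ∞ M]

lemma mvfderiv_mfderivWithin_extChartAt_symm {f : M → F} {x : M} {y : E}
    (hy : y ∈ (extChartAt 𝓘(ℝ, E) x).target)
    (hf : MDiffAt f ((extChartAt 𝓘(ℝ, E) x).symm y)) (w : E) :
    d% f ((extChartAt 𝓘(ℝ, E) x).symm y)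
        (mfderiv[Set.range 𝓘(ℝ, E)] (extChartAt 𝓘(ℝ, E) x).symm y w) =
      fderiv ℝ (f ∘ (extChartAt 𝓘(ℝ, E) x).symm) y w := by
  have : IsManifold 𝓘(ℝ, E) 1 M := inferInstance
  have hφ : MDiffAt[Set.range 𝓘(ℝ, E)] (extChartAt 𝓘(ℝ, E) x).symm y :=
    mdifferentiableWithinAt_extChartAt_symm hy
  have hchain := mfderiv_comp_mfderivWithin y hf hφ
    (by rw [ModelWithCorners.range_eq_univ]; exact uniqueMDiffWithinAt_univ _)
  rw [ModelWithCorners.range_eq_univ] at hchain ⊢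
  rw [mfderivWithin_univ, mfderiv_eq_fderiv] at hchain
  exact (DFunLike.congr_fun hchain _).symm

lemma mvfderiv_apply_extChartAt_symm {f : M → F} {x : M} {y : E}
    (hy : y ∈ (extChartAt 𝓘(ℝ, E) x).target)
    (hf : MDiffAt f ((extChartAt 𝓘(ℝ, E) x).symm y)) (V : ∀ x : M, TangentSpace 𝓘(ℝ, E) x) :
    d% f ((extChartAt 𝓘(ℝ, E) x).symm y) (V ((extChartAt 𝓘(ℝ, E) x).symm y)) =
      fderiv ℝ (f ∘ (extChartAt 𝓘(ℝ, E) x).symm) y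
        (mpullbackWithin 𝓘(ℝ, E) 𝓘(ℝ, E) (extChartAt 𝓘(ℝ, E) x).symm V (Set.range 𝓘(ℝ, E)) y) := by
  have : IsManifold 𝓘(ℝ, E) 1 M := inferInstance
  have hinv : (mfderiv[Set.range 𝓘(ℝ, E)] (extChartAt 𝓘(ℝ, E) x).symm y).IsInvertible :=
    isInvertible_mfderivWithin_extChartAt_symm hy
  have hV := hinv.self_apply_inverse (V ((extChartAt 𝓘(ℝ, E) x).symm y))
  rw [mpullbackWithin_apply]
  conv_lhs => rw [← hV]
  exact mvfderiv_mfderivWithin_extChartAt_symm hy hf _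

lemma mdifferentiableAt_and_mvfderiv_of_comp_extChartAt_symm {g : M → F} {x : M} {h : E → F}
    (hh : DifferentiableAt ℝ h (extChartAt 𝓘(ℝ, E) x x))
    (hgh : g ∘ (extChartAt 𝓘(ℝ, E) x).symm =ᶠ[𝓝 (extChartAt 𝓘(ℝ, E) x x)] h) :
    MDiffAt g x ∧ ∀ v : TangentSpace 𝓘(ℝ, E) x,
      d% g x v = fderiv ℝ h (extChartAt 𝓘(ℝ, E) x x) v := by
  have : IsManifold 𝓘(ℝ, E) 1 M := inferInstance
  have hφ : MDiffAt (extChartAt 𝓘(ℝ, E) x) x :=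
    mdifferentiableAt_extChartAt (mem_chart_source _ _)
  have hd : MDiffAt g x := by
    refine (hh.mdifferentiableAt.comp x hφ).congr_of_eventuallyEq ?_
    have h1 := (continuousAt_extChartAt (I := 𝓘(ℝ, E)) x).eventually hgh
    filter_upwards [h1, extChartAt_source_mem_nhds (I := 𝓘(ℝ, E)) x] with y hy hys
    rw [Function.comp_apply, ← hy, Function.comp_apply, PartialEquiv.left_inv _ hys]
  refine ⟨hd, fun v ↦ ?_⟩
  rw [mvfderiv_apply_eq_fderiv hd, hgh.fderiv_eq]

/-- The vector field `V` in the coordinates of the preferred chart at `x`. -/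
def coordinateExpression (x : M) (V : ∀ x : M, TangentSpace 𝓘(ℝ, E) x) (y : E) : E :=
  mpullbackWithin 𝓘(ℝ, E) 𝓘(ℝ, E) (extChartAt 𝓘(ℝ, E) x).symm V (Set.range 𝓘(ℝ, E)) y

lemma coordinateExpression_self (x : M) (V : ∀ x : M, TangentSpace 𝓘(ℝ, E) x) :
    coordinateExpression x V (extChartAt 𝓘(ℝ, E) x x) = V x := by
  have : IsManifold 𝓘(ℝ, E) 1 M := inferInstance
  rw [coordinateExpression, mpullbackWithin_apply]
  have h := mfderivWithin_extChartAt_symm_inverse_apply (I := 𝓘(ℝ, E)) (x := x)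
    (V ((extChartAt 𝓘(ℝ, E) x).symm (extChartAt 𝓘(ℝ, E) x x)))
  refine Eq.trans h ?_
  rw [extChartAt_to_inv]

lemma differentiableAt_coordinateExpression [CompleteSpace E] {x : M}
    {V : ∀ x : M, TangentSpace 𝓘(ℝ, E) x} (hV : MDiffAt (T% V) x) :
    DifferentiableAt ℝ (coordinateExpression x V) (extChartAt 𝓘(ℝ, E) x x) := by
  have : IsManifold 𝓘(ℝ, E) 2 M := inferInstance
  have : DifferentiableWithinAt ℝ (coordinateExpression x V)
      ((extChartAt 𝓘(ℝ, E) x).symm ⁻¹' Set.univ ∩ Set.range 𝓘(ℝ, E)) (extChartAt 𝓘(ℝ, E) x x) :=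
    MDifferentiableWithinAt.differentiableWithinAt_mpullbackWithin_vectorField
      (mdifferentiableWithinAt_univ.2 hV)
  rwa [Set.preimage_univ, Set.univ_inter, ModelWithCorners.range_eq_univ,
    differentiableWithinAt_univ] at this

lemma mlieBracket_eq_lieBracket_coordinateExpression (x : M)
    (X Y : ∀ x : M, TangentSpace 𝓘(ℝ, E) x) :
    mlieBracket 𝓘(ℝ, E) X Y x = lieBracket ℝ (coordinateExpression x X)
      (coordinateExpression x Y) (extChartAt 𝓘(ℝ, E) x x) := by
  have : IsManifold 𝓘(ℝ, E) 1 M := inferInstance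
  have hs : (extChartAt 𝓘(ℝ, E) x).symm ⁻¹' Set.univ ∩ Set.range 𝓘(ℝ, E) = Set.univ := by
    rw [Set.preimage_univ, Set.univ_inter, ModelWithCorners.range_eq_univ]
  have h (v : E) : (mfderiv% (extChartAt 𝓘(ℝ, E) x) x).inverse v = v := by
    rw [mfderiv_extChartAt_self]
    exact DFunLike.congr_fun (ContinuousLinearMap.inverse_id (R := ℝ) (M := E)) v
  rw [← mlieBracketWithin_univ, mlieBracketWithin_apply, hs, ← lieBracketWithin_univ]
  exact h _

lemma mdifferentiableAt_and_mvfderiv_mvfderiv_apply [CompleteSpace E] {f : M → F}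
    (hf : ContMDiff 𝓘(ℝ, E) 𝓘(ℝ, F) ∞ f)
    {V : ∀ x : M, TangentSpace 𝓘(ℝ, E) x} {x : M} (hV : MDiffAt (T% V) x) :
    MDiffAt (fun y ↦ d% f y (V y)) x ∧ ∀ v : TangentSpace 𝓘(ℝ, E) x,
      d% (fun y ↦ d% f y (V y)) x v =
        fderiv ℝ (fderiv ℝ (f ∘ (extChartAt 𝓘(ℝ, E) x).symm)) (extChartAt 𝓘(ℝ, E) x x) v
          (coordinateExpression x V (extChartAt 𝓘(ℝ, E) x x)) +
        fderiv ℝ (f ∘ (extChartAt 𝓘(ℝ, E) x).symm) (extChartAt 𝓘(ℝ, E) x x)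
          (fderiv ℝ (coordinateExpression x V) (extChartAt 𝓘(ℝ, E) x x) v) := by
  have hf' : DifferentiableAt ℝ (fderiv ℝ (f ∘ (extChartAt 𝓘(ℝ, E) x).symm))
      (extChartAt 𝓘(ℝ, E) x x) :=
    ((contDiffAt_comp_extChartAt_symm hf x).fderiv_right (m := 1)
      (by rw [one_add_one_eq_two]; exact ENat.LEInfty.out)).differentiableAt (by simp)
  have hV := differentiableAt_coordinateExpression hV
  obtain ⟨h1, h2⟩ := mdifferentiableAt_and_mvfderiv_of_comp_extChartAt_symm
    (g := fun y ↦ d% f y (V y)) (hf'.clm_apply hV) (by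
      filter_upwards [extChartAt_target_mem_nhds (I := 𝓘(ℝ, E)) x] with y hy
      exact mvfderiv_apply_extChartAt_symm hy (hf.mdifferentiableAt (by simp)) V)
  refine ⟨h1, fun v ↦ ?_⟩
  rw [h2, fderiv_clm_apply hf' hV]
  exact add_comm _ _

/-- The Lie bracket of two vector fields acts on functions as the commutator of derivations. -/
lemma mvfderiv_mlieBracket_apply [CompleteSpace E] {f : M → F}
    (hf : ContMDiff 𝓘(ℝ, E) 𝓘(ℝ, F) ∞ f)
    {X Y : ∀ x : M, TangentSpace 𝓘(ℝ, E) x} {x : M} (hX : MDiffAt (T% X) x)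
    (hY : MDiffAt (T% Y) x) :
    d% f x (mlieBracket 𝓘(ℝ, E) X Y x) =
      d% (fun y ↦ d% f y (Y y)) x (X x) - d% (fun y ↦ d% f y (X y)) x (Y x) := by
  -- Symmetry of the second derivative cancels the second-order terms of the commutator.
  have hs : IsSymmSndFDerivAt ℝ (f ∘ (extChartAt 𝓘(ℝ, E) x).symm) (extChartAt 𝓘(ℝ, E) x x) :=
    (contDiffAt_comp_extChartAt_symm hf x).isSymmSndFDerivAt (by simpa using ENat.LEInfty.out)
  refine (mvfderiv_apply_eq_fderiv (hf.mdifferentiableAt (by simp)) _).trans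
    (Eq.trans ?_ (congrArg₂ (· - ·) ((mdifferentiableAt_and_mvfderiv_mvfderiv_apply hf hY).2 (X x))
      ((mdifferentiableAt_and_mvfderiv_mvfderiv_apply hf hX).2 (Y x))).symm)
  rw [mlieBracket_eq_lieBracket_coordinateExpression, lieBracket,
    coordinateExpression_self, coordinateExpression_self, map_sub]
  have := hs.eq (X x) (Y x)
  change _ = _ + _ - (_ + _)
  rw [this]
  abel

lemma mvfderiv_coordinateField {f : M → F} {p x : M} (hx : x ∈ (extChartAt 𝓘(ℝ, E) p).source)
    (hf : MDiffAt f x) (w : E) :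
    d% f x (coordinateField p w x) =
      fderiv ℝ (f ∘ (extChartAt 𝓘(ℝ, E) p).symm) (extChartAt 𝓘(ℝ, E) p x) w := by
  have : IsManifold 𝓘(ℝ, E) 1 M := inferInstance
  have hx' : x ∈ (chartAt E p).source := by rwa [extChartAt_source] at hx
  have h := mvfderiv_mfderivWithin_extChartAt_symm ((extChartAt 𝓘(ℝ, E) p).map_source hx)
    (f := f) (by rwa [(extChartAt 𝓘(ℝ, E) p).left_inv hx]) w
  rw [← h, coordinateField, TangentBundle.symmL_trivializationAt hx']
  have hcongr (y : M) (hy : y = x) (w : E) : d% f x w = d% f y w := by rw [hy]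
  exact hcongr _ ((extChartAt 𝓘(ℝ, E) p).left_inv hx) _

lemma mdifferentiableAt_coordinateField (p : M) (w : E) : MDiffAt (T% (coordinateField p w)) p := by
  have : IsManifold 𝓘(ℝ, E) 1 M := inferInstance
  rw [mdifferentiableAt_section]
  refine (mdifferentiableAt_const (c := w)).congr_of_eventuallyEq ?_
  have hp : (trivializationAt E (TangentSpace 𝓘(ℝ, E) : M → Type _) p).baseSet ∈ 𝓝 p :=
    (trivializationAt E (TangentSpace 𝓘(ℝ, E) : M → Type _) p).open_baseSet.mem_nhds
      (FiberBundle.mem_baseSet_trivializationAt' p)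
  filter_upwards [hp] with x hx
  rw [coordinateField, Bundle.Trivialization.symmL_apply _ hx,
    Bundle.Trivialization.apply_mk_symm _ hx]

end Bracket

/-! ### The Maurer-Cartan form and its structure equation -/

section MaurerCartan

open VectorField

lemma contMDiff_quaternionSphere_coe :
    ContMDiff (𝓡 3) 𝓘(ℝ, ℍ[ℝ]) ∞ ((↑) : QuaternionSphere → ℍ[ℝ]) := contMDiff_coe_sphere

lemma mdifferentiableAt_quaternionSphere_coe (x : QuaternionSphere) :
    MDifferentiableAt (𝓡 3) 𝓘(ℝ, ℍ[ℝ]) ((↑) : QuaternionSphere → ℍ[ℝ]) x :=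
  contMDiff_quaternionSphere_coe.mdifferentiableAt (by simp)

lemma star_mul_self_quaternionSphere (x : QuaternionSphere) : star (x : ℍ[ℝ]) * x = 1 := by
  rw [Quaternion.star_mul_self, Quaternion.normSq_eq_norm_mul_self,
    mem_sphere_zero_iff_norm.1 x.2]
  simp

/-- The conjugation of quaternions, as a continuous linear map. -/
def quaternionStar : ℍ[ℝ] →L[ℝ] ℍ[ℝ] :=
  LinearMap.toContinuousLinearMap
    { toFun := star
      map_add' := star_add
      map_smul' := fun r q ↦ Quaternion.star_smul r q }

/-- Differentiability of a vector field at a point. -/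
abbrev IsMDiffFieldAt (Y : ∀ x : QuaternionSphere, TangentSpace (𝓡 3) x) (x : QuaternionSphere) :
    Prop :=
  MDifferentiableAt (𝓡 3) ((𝓡 3).prod 𝓘(ℝ, EuclideanSpace ℝ (Fin 3)))
    (fun y ↦ Bundle.TotalSpace.mk' (EuclideanSpace ℝ (Fin 3)) y (Y y)) x

/-- The Maurer-Cartan form of the group of unit quaternions, with values in the space of imaginary
quaternions. -/
def maurerCartan (x : QuaternionSphere) :
    TangentSpace (𝓡 3) x →L[ℝ] EuclideanSpace ℝ (Fin 3) :=
  (imVector.comp (ContinuousLinearMap.mul ℝ ℍ[ℝ] (star (x : ℍ[ℝ])))).comp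
    (mvfderiv (𝓡 3) ((↑) : QuaternionSphere → ℍ[ℝ]) x)

lemma maurerCartan_apply (x : QuaternionSphere) (v : TangentSpace (𝓡 3) x) :
    maurerCartan x v =
      imVector (star (x : ℍ[ℝ]) * mvfderiv (𝓡 3) ((↑) : QuaternionSphere → ℍ[ℝ]) x v) := rfl

/-- Tangent vectors at `x` are orthogonal to `x`, so `star x * dx` has no real part and `imVector`
loses nothing. -/
lemma mvfderiv_coe_eq_mul (x : QuaternionSphere) (v : TangentSpace (𝓡 3) x) :
    mvfderiv (𝓡 3) ((↑) : QuaternionSphere → ℍ[ℝ]) x v = x * imQuaternion (maurerCartan x v) := by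
  have hx := star_mul_self_quaternionSphere x
  have hx' : (x : ℍ[ℝ]) * star (x : ℍ[ℝ]) = 1 := by
    rw [Quaternion.self_mul_star, ← Quaternion.star_mul_self, hx]
  have h : mvfderiv (𝓡 3) ((↑) : QuaternionSphere → ℍ[ℝ]) x v ∈ (ℝ ∙ (x : ℍ[ℝ]))ᗮ := by
    rw [← range_mvfderiv_subtypeVal (n := 3) x]
    exact ⟨v, rfl⟩
  rw [maurerCartan_apply, imQuaternion_imVector, ← mul_assoc, hx', one_mul]
  rw [Submodule.mem_orthogonal_singleton_iff_inner_left, Quaternion.inner_def] at h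
  simp at h ⊢
  linarith

lemma maurerCartan_injective (x : QuaternionSphere) : Function.Injective (maurerCartan x) := by
  intro v w h
  refine injective_mvfderiv_subtypeVal_sphere (n := 3) x ?_
  rw [mvfderiv_coe_eq_mul, mvfderiv_coe_eq_mul, h]

/-- The Maurer-Cartan form as a linear isomorphism. -/
def maurerCartanEquiv (x : QuaternionSphere) :
    TangentSpace (𝓡 3) x ≃ₗ[ℝ] EuclideanSpace ℝ (Fin 3) :=
  LinearEquiv.ofInjectiveOfFinrankEq (maurerCartan x).toLinearMap (maurerCartan_injective x) rfl

/-- The left-invariant vector field with given Maurer-Cartan form. -/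
def leftField (u : EuclideanSpace ℝ (Fin 3)) (x : QuaternionSphere) : TangentSpace (𝓡 3) x :=
  (maurerCartanEquiv x).symm u

@[simp] lemma maurerCartan_leftField (u : EuclideanSpace ℝ (Fin 3)) (x : QuaternionSphere) :
    maurerCartan x (leftField u x) = u :=
  (maurerCartanEquiv x).apply_symm_apply u

@[simp] lemma leftField_maurerCartan (x : QuaternionSphere) (v : TangentSpace (𝓡 3) x) :
    leftField (maurerCartan x v) x = v :=
  (maurerCartanEquiv x).symm_apply_apply v

lemma maurerCartan_mfderiv_mul_left (a x : QuaternionSphere) (v : TangentSpace (𝓡 3) x) :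
    maurerCartan (a * x) (mfderiv (𝓡 3) (𝓡 3) (fun y ↦ a * y) x v) = maurerCartan x v := by
  have hm : MDifferentiableAt (𝓡 3) (𝓡 3) (fun y : QuaternionSphere ↦ a * y) x :=
    (contMDiff_mul_left (I := 𝓡 3) (n := ∞)).mdifferentiableAt (by simp)
  have h1 : HasMFDerivAt (𝓡 3) 𝓘(ℝ, ℍ[ℝ]) (fun y : QuaternionSphere ↦ ((a * y : _) : ℍ[ℝ])) x
      ((mfderiv (𝓡 3) 𝓘(ℝ, ℍ[ℝ]) ((↑) : QuaternionSphere → ℍ[ℝ]) (a * x)).comp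
        (mfderiv (𝓡 3) (𝓡 3) (fun y ↦ a * y) x)) :=
    (mdifferentiableAt_quaternionSphere_coe (a * x)).hasMFDerivAt.comp x hm.hasMFDerivAt
  have h2 : HasMFDerivAt (𝓡 3) 𝓘(ℝ, ℍ[ℝ]) (fun y : QuaternionSphere ↦ ((a * y : _) : ℍ[ℝ])) x
      ((ContinuousLinearMap.mul ℝ ℍ[ℝ] a).comp
        (mfderiv (𝓡 3) 𝓘(ℝ, ℍ[ℝ]) ((↑) : QuaternionSphere → ℍ[ℝ]) x)) :=
    (ContinuousLinearMap.mul ℝ ℍ[ℝ] (a : ℍ[ℝ])).hasMFDerivAt.comp x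
      (mdifferentiableAt_quaternionSphere_coe x).hasMFDerivAt
  have h3 := DFunLike.congr_fun (hasMFDerivAt_unique h1 h2) v
  have h4 : mvfderiv (𝓡 3) ((↑) : QuaternionSphere → ℍ[ℝ]) (a * x) (mfderiv (𝓡 3) (𝓡 3) (fun y ↦ a * y) x v)
      = a * mvfderiv (𝓡 3) ((↑) : QuaternionSphere → ℍ[ℝ]) x v := h3
  rw [maurerCartan_apply, h4, maurerCartan_apply]
  have : ((a * x : QuaternionSphere) : ℍ[ℝ]) = a * x := rfl
  rw [this, star_mul, mul_assoc, ← mul_assoc (star (a : ℍ[ℝ])), star_mul_self_quaternionSphere,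
    one_mul]

lemma mdifferentiableAt_leftField (u : EuclideanSpace ℝ (Fin 3)) (x : QuaternionSphere) :
    IsMDiffFieldAt (leftField u) x := by
  -- The identification with `mulInvariantVectorField` supplies the differentiability.
  have h : leftField u = mulInvariantVectorField (I := 𝓡 3) (G := QuaternionSphere)
      (leftField u 1) := by
    funext x
    refine maurerCartan_injective x ?_
    have h1 := maurerCartan_mfderiv_mul_left x 1 (leftField u 1)
    have h2 (w : EuclideanSpace ℝ (Fin 3)) : maurerCartan (x * 1) w = maurerCartan x w := by
      rw [mul_one]
    rw [maurerCartan_leftField] at h1 ⊢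
    exact h1.symm.trans (h2 _)
  have : LieGroup (𝓡 3) (minSmoothness ℝ 3) QuaternionSphere := by
    rw [minSmoothness_of_isRCLikeNormedField]
    exact .of_le (n := ∞) ENat.LEInfty.out
  rw [h]
  exact mdifferentiableAt_mulInvariantVectorField _

lemma mdifferentiableAt_maurerCartan {Y : ∀ x : QuaternionSphere, TangentSpace (𝓡 3) x}
    {x : QuaternionSphere} (hY : IsMDiffFieldAt Y x) :
    MDifferentiableAt (𝓡 3) 𝓘(ℝ, EuclideanSpace ℝ (Fin 3)) (fun y ↦ maurerCartan y (Y y)) x := by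
  have h := (mdifferentiableAt_and_mvfderiv_mvfderiv_apply contMDiff_quaternionSphere_coe hY).1
  have hs : MDifferentiableAt (𝓡 3) 𝓘(ℝ, ℍ[ℝ])
      (fun y : QuaternionSphere ↦ star (y : ℍ[ℝ])) x :=
    quaternionStar.mdifferentiableAt.comp x (mdifferentiableAt_quaternionSphere_coe x)
  have hm := ((ContinuousLinearMap.mul ℝ ℍ[ℝ]).mdifferentiableAt.comp x hs).clm_apply h
  exact imVector.mdifferentiableAt.comp x hm

lemma mvfderiv_coe_mul_imQuaternion {η : QuaternionSphere → EuclideanSpace ℝ (Fin 3)}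
    {x : QuaternionSphere} (hη : MDifferentiableAt (𝓡 3) 𝓘(ℝ, EuclideanSpace ℝ (Fin 3)) η x)
    (v : TangentSpace (𝓡 3) x) :
    mvfderiv (𝓡 3) (fun y : QuaternionSphere ↦ (y : ℍ[ℝ]) * imQuaternion (η y)) x v =
      x * (imQuaternion (maurerCartan x v) * imQuaternion (η x) +
        imQuaternion (mvfderiv (𝓡 3) η x v)) := by
  have h1 : HasMFDerivAt (𝓡 3) 𝓘(ℝ, ℍ[ℝ]) (fun y : QuaternionSphere ↦ imQuaternion (η y)) x _ :=
    imQuaternion.hasMFDerivAt.comp x hη.hasMFDerivAt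
  have h2 := (mdifferentiableAt_quaternionSphere_coe x).hasMFDerivAt.mul' h1
  have h3 : mvfderiv (𝓡 3) (fun y : QuaternionSphere ↦ (y : ℍ[ℝ]) * imQuaternion (η y)) x v =
      x * imQuaternion (mvfderiv (𝓡 3) η x v) +
        mvfderiv (𝓡 3) ((↑) : QuaternionSphere → ℍ[ℝ]) x v * imQuaternion (η x) :=
    DFunLike.congr_fun h2.mfderiv v
  rw [h3, mvfderiv_coe_eq_mul, mul_add, mul_assoc, add_comm]

/-- The structure equation: apply the commutator formula to the inclusion in `ℍ[ℝ]`, whose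
derivative along `Y` at `y` is `y θ(Y)`, `θ` being the Maurer-Cartan form. The product rule produces
the quaternion commutator. -/
lemma maurerCartan_mlieBracket {X Y : ∀ x : QuaternionSphere, TangentSpace (𝓡 3) x}
    {x : QuaternionSphere} (hX : IsMDiffFieldAt X x) (hY : IsMDiffFieldAt Y x) :
    maurerCartan x (mlieBracket (𝓡 3) X Y x) =
      imBracket (maurerCartan x (X x)) (maurerCartan x (Y x)) +
        mvfderiv (𝓡 3) (fun y ↦ maurerCartan y (Y y)) x (X x) -
        mvfderiv (𝓡 3) (fun y ↦ maurerCartan y (X y)) x (Y x) := by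
  have h := mvfderiv_mlieBracket_apply contMDiff_quaternionSphere_coe hX hY
  simp only [mvfderiv_coe_eq_mul] at h
  rw [mvfderiv_coe_mul_imQuaternion (mdifferentiableAt_maurerCartan hX),
    mvfderiv_coe_mul_imQuaternion (mdifferentiableAt_maurerCartan hY), ← mul_sub] at h
  have h2 := congrArg (fun q ↦ imVector (star (x : ℍ[ℝ]) * q)) h
  simp only [← mul_assoc, star_mul_self_quaternionSphere, one_mul, imVector_imQuaternion] at h2
  rw [h2, imBracket_apply]
  simp only [map_sub, map_add, imVector_imQuaternion]
  abel

end MaurerCartan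

/-! ### Levi-Civita connections of left-invariant metrics -/

section LeviCivita

open VectorField

/-- The left translation of imaginary quaternions to the tangent space at `x`. -/
def leftFieldL (x : QuaternionSphere) : EuclideanSpace ℝ (Fin 3) →L[ℝ] TangentSpace (𝓡 3) x :=
  LinearMap.toContinuousLinearMap (maurerCartanEquiv x).symm.toLinearMap

lemma mvfderiv_bilinear_apply
    (β : EuclideanSpace ℝ (Fin 3) →L[ℝ] EuclideanSpace ℝ (Fin 3) →L[ℝ] ℝ)
    {η ζ : QuaternionSphere → EuclideanSpace ℝ (Fin 3)} {x : QuaternionSphere}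
    (hη : MDifferentiableAt (𝓡 3) 𝓘(ℝ, EuclideanSpace ℝ (Fin 3)) η x)
    (hζ : MDifferentiableAt (𝓡 3) 𝓘(ℝ, EuclideanSpace ℝ (Fin 3)) ζ x)
    (v : TangentSpace (𝓡 3) x) :
    mvfderiv (𝓡 3) (fun y ↦ β (η y) (ζ y)) x v =
      β (mvfderiv (𝓡 3) η x v) (ζ x) + β (η x) (mvfderiv (𝓡 3) ζ x v) := by
  have hd {η : QuaternionSphere → EuclideanSpace ℝ (Fin 3)}
      (hη : MDifferentiableAt (𝓡 3) 𝓘(ℝ, EuclideanSpace ℝ (Fin 3)) η x) :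
      DifferentiableAt ℝ (η ∘ (extChartAt (𝓡 3) x).symm) (extChartAt (𝓡 3) x x) := by
    have h := hη.differentiableWithinAt_writtenInExtChartAt
    rw [ModelWithCorners.range_eq_univ, differentiableWithinAt_univ] at h
    exact h
  have hx : (extChartAt (𝓡 3) x).symm (extChartAt (𝓡 3) x x) = x := extChartAt_to_inv x
  have h := (β.hasFDerivAt_of_bilinear (hd hη).hasFDerivAt (hd hζ).hasFDerivAt)
  rw [(mdifferentiableAt_and_mvfderiv_of_comp_extChartAt_symm h.differentiableAt .rfl).2,
    mvfderiv_apply_eq_fderiv hη, mvfderiv_apply_eq_fderiv hζ, h.fderiv]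
  simp only [Function.comp_apply, hx]
  exact add_comm _ _

/-- The left-invariant connection on `S³` determined by a bilinear map on the Lie algebra. -/
def leftConnection
    (A : EuclideanSpace ℝ (Fin 3) →L[ℝ] EuclideanSpace ℝ (Fin 3) →L[ℝ] EuclideanSpace ℝ (Fin 3)) :
    CovariantDerivative (𝓡 3) (EuclideanSpace ℝ (Fin 3))
      (TangentSpace (𝓡 3) : QuaternionSphere → Type _) where
  toFun Y x := (leftFieldL x).comp
    (mvfderiv (𝓡 3) (fun y ↦ maurerCartan y (Y y)) x +
      (A.flip (maurerCartan x (Y x))).comp (maurerCartan x))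
  isCovariantDerivativeOnUniv :=
    { add := by
        intro σ σ' x hσ hσ' _
        have h : mvfderiv (𝓡 3) (fun y ↦ maurerCartan y ((σ + σ') y)) x =
            mvfderiv (𝓡 3) (fun y ↦ maurerCartan y (σ y)) x +
              mvfderiv (𝓡 3) (fun y ↦ maurerCartan y (σ' y)) x := by
          rw [← mvfderiv_add (mdifferentiableAt_maurerCartan hσ)
            (mdifferentiableAt_maurerCartan hσ')]
          congr 1
          funext y
          simp
        rw [h]
        ext v
        simp
        abel
      leibniz := by
        intro σ f x hσ hf _
        have h : mvfderiv (𝓡 3) (fun y ↦ maurerCartan y ((f • σ) y)) x =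
            f x • mvfderiv (𝓡 3) (fun y ↦ maurerCartan y (σ y)) x +
              (mvfderiv (𝓡 3) f x).smulRight (maurerCartan x (σ x)) := by
          rw [← mvfderiv_smul hf (mdifferentiableAt_maurerCartan hσ)]
          congr 1
          funext y
          simp
        rw [h]
        ext v
        have hv : leftFieldL x (maurerCartan x (σ x)) = σ x := leftField_maurerCartan x (σ x)
        simp [hv]
        abel }

lemma maurerCartan_leftConnection
    (A : EuclideanSpace ℝ (Fin 3) →L[ℝ] EuclideanSpace ℝ (Fin 3) →L[ℝ] EuclideanSpace ℝ (Fin 3))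
    (Y : ∀ x : QuaternionSphere, TangentSpace (𝓡 3) x) (x : QuaternionSphere)
    (v : TangentSpace (𝓡 3) x) :
    maurerCartan x (leftConnection A Y x v) =
      mvfderiv (𝓡 3) (fun y ↦ maurerCartan y (Y y)) x v +
        A (maurerCartan x v) (maurerCartan x (Y x)) :=
  maurerCartan_leftField _ _

namespace PseudoRiemannianMetric

variable {g g' : PseudoRiemannianMetric (EuclideanSpace ℝ (Fin 3)) QuaternionSphere}

/-- The restriction of a metric to the tangent space at `1`, as a form on the imaginary
quaternions. -/
def formAtOne (g : PseudoRiemannianMetric (EuclideanSpace ℝ (Fin 3)) QuaternionSphere) :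
    EuclideanSpace ℝ (Fin 3) →L[ℝ] EuclideanSpace ℝ (Fin 3) →L[ℝ] ℝ :=
  (LinearMap.mk₂ ℝ (fun u w ↦ g.val 1 (leftFieldL 1 u) (leftFieldL 1 w)) (by simp) (by simp)
    (by simp) (by simp)).toContinuousBilinearMap

lemma formAtOne_apply (u w : EuclideanSpace ℝ (Fin 3)) :
    g.formAtOne u w = g.val 1 (leftField u 1) (leftField w 1) := rfl

lemma formAtOne_symm (u w : EuclideanSpace ℝ (Fin 3)) : g.formAtOne u w = g.formAtOne w u :=
  g.symm 1 _ _

lemma formAtOne_nondegenerate (u : EuclideanSpace ℝ (Fin 3)) (h : ∀ w, g.formAtOne u w = 0) :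
    u = 0 := by
  have h0 : leftField u 1 = 0 := g.nondegenerate 1 _ fun w ↦ by
    have := h (maurerCartan 1 w)
    rwa [formAtOne_apply, leftField_maurerCartan] at this
  rw [← maurerCartan_leftField u 1, h0, map_zero]

lemma IsLeftInvariant.val_eq (hg : g.IsLeftInvariant) (x : QuaternionSphere)
    (v w : TangentSpace (𝓡 3) x) :
    g.val x v w = g.formAtOne (maurerCartan x v) (maurerCartan x w) := by
  -- The point is generalized because `TangentSpace` at `x` and at `x * 1` are not syntactically the
  -- same type.
  suffices h : ∀ y, y = x * 1 → ∀ v w : TangentSpace (𝓡 3) y,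
      g.val y v w = g.formAtOne (maurerCartan y v) (maurerCartan y w) from
    h x (mul_one x).symm v w
  rintro _ rfl v w
  have key (v : TangentSpace (𝓡 3) (x * 1)) :
      mfderiv (𝓡 3) (𝓡 3) (fun y ↦ x * y) 1 (leftField (maurerCartan (x * 1) v) 1) = v := by
    refine maurerCartan_injective _ ?_
    rw [maurerCartan_mfderiv_mul_left, maurerCartan_leftField]
  have := hg x 1 (leftField (maurerCartan (x * 1) v) 1) (leftField (maurerCartan (x * 1) w) 1)
  rw [key, key] at this
  exact this

lemma IsLeftInvariant.mvfderiv_val (hg : g.IsLeftInvariant)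
    {Y Z : ∀ x : QuaternionSphere, TangentSpace (𝓡 3) x} {x : QuaternionSphere}
    (hY : IsMDiffFieldAt Y x) (hZ : IsMDiffFieldAt Z x) (v : TangentSpace (𝓡 3) x) :
    mvfderiv (𝓡 3) (fun y ↦ g.val y (Y y) (Z y)) x v =
      g.formAtOne (mvfderiv (𝓡 3) (fun y ↦ maurerCartan y (Y y)) x v) (maurerCartan x (Z x)) +
      g.formAtOne (maurerCartan x (Y x)) (mvfderiv (𝓡 3) (fun y ↦ maurerCartan y (Z y)) x v) := by
  simp only [hg.val_eq]
  exact mvfderiv_bilinear_apply g.formAtOne (mdifferentiableAt_maurerCartan hY)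
    (mdifferentiableAt_maurerCartan hZ) v

/-- The structure equation turns torsion-freeness into `A u v - A v u = [u, v]`, and metric
compatibility into skewness of each `A u`; the Koszul formula provides such an `A`. -/
lemma IsLeftInvariant.exists_isLeviCivita (hg : g.IsLeftInvariant) :
    ∃ A, g.IsLeviCivita (leftConnection A) ∧
      ∀ u w, g.formAtOne (A u u) w = g.formAtOne u (imBracket w u) := by
  obtain ⟨A, hA, hA'⟩ := exists_koszul g.formAtOne formAtOne_symm formAtOne_nondegenerate
  refine ⟨A, ⟨?_, ?_⟩, fun u w ↦ ?_⟩
  · have : IsManifold (𝓡 3) 2 QuaternionSphere := inferInstance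
    rw [CovariantDerivative.torsion_eq_zero_iff]
    intro X Y x hX hY
    refine maurerCartan_injective x ?_
    rw [map_sub, maurerCartan_leftConnection, maurerCartan_leftConnection,
      maurerCartan_mlieBracket hX hY, ← hA]
    abel
  · intro Y Z x hY hZ v
    refine (hg.mvfderiv_val hY hZ v).trans ?_
    rw [hg.val_eq, hg.val_eq, maurerCartan_leftConnection, maurerCartan_leftConnection]
    simp only [map_add, add_apply]
    linarith [hA' (maurerCartan x v) (maurerCartan x (Y x)) (maurerCartan x (Z x))]
  · have h1 := hA' u u w
    have h2 := hA' w u u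
    rw [formAtOne_symm (A w u) u] at h2
    rw [← hA w u, map_sub]
    linarith

/-- The Levi-Civita connection of a left-invariant metric on left-invariant vector fields. -/
lemma IsLeftInvariant.formAtOne_cov_leftField (hg : g.IsLeftInvariant)
    {cov : CovariantDerivative (𝓡 3) (EuclideanSpace ℝ (Fin 3))
      (TangentSpace (𝓡 3) : QuaternionSphere → Type _)} (hcov : g.IsLeviCivita cov)
    (x : QuaternionSphere) (u w : EuclideanSpace ℝ (Fin 3)) :
    g.formAtOne (maurerCartan x (cov (leftField u) x (leftField u x))) w =
      g.formAtOne u (imBracket w u) := by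
  have : IsManifold (𝓡 3) 2 QuaternionSphere := inferInstance
  obtain ⟨ht, hm⟩ := hcov
  rw [CovariantDerivative.torsion_eq_zero_iff] at ht
  -- The metric is constant on left-invariant fields, so compatibility loses its derivative term.
  have hmet (u v w : EuclideanSpace ℝ (Fin 3)) :
      g.formAtOne (maurerCartan x (cov (leftField v) x (leftField u x))) w +
        g.formAtOne v (maurerCartan x (cov (leftField w) x (leftField u x))) = 0 := by
    have h : mvfderiv (𝓡 3) (fun y ↦ g.val y (leftField v y) (leftField w y)) x (leftField u x) =
        _ := hm (leftField v) (leftField w) x (mdifferentiableAt_leftField v x)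
          (mdifferentiableAt_leftField w x) (leftField u x)
    simp only [hg.val_eq, maurerCartan_leftField] at h
    rw [← h, mvfderiv_const]
    rfl
  have hb := congrArg (maurerCartan x)
    (ht (mdifferentiableAt_leftField w x) (mdifferentiableAt_leftField u x))
  rw [maurerCartan_mlieBracket (mdifferentiableAt_leftField w x) (mdifferentiableAt_leftField u x),
    map_sub] at hb
  simp only [maurerCartan_leftField, mvfderiv_const] at hb
  have h1 := hmet u u w
  have h2 := hmet w u u
  rw [formAtOne_symm _ u] at h2
  have h3 := congrArg (g.formAtOne u) hb
  simp only [map_sub, map_add] at h3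
  simp at h3
  linarith

end PseudoRiemannianMetric

end LeviCivita

/-! ### Covariant acceleration in terms of the body velocity -/

section Acceleration

open Filter
open scoped Topology

/-- The difference of two connections is tensorial. Comparison with `leftConnection 0`, for which
left-invariant fields are parallel, reduces any connection to its values on such fields. -/
lemma maurerCartan_cov (cov : CovariantDerivative (𝓡 3) (EuclideanSpace ℝ (Fin 3))
      (TangentSpace (𝓡 3) : QuaternionSphere → Type _))
    {Y : ∀ x : QuaternionSphere, TangentSpace (𝓡 3) x} {x : QuaternionSphere}
    (hY : IsMDiffFieldAt Y x) (v : TangentSpace (𝓡 3) x) :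
    maurerCartan x (cov Y x v) = mvfderiv (𝓡 3) (fun y ↦ maurerCartan y (Y y)) x v +
      maurerCartan x (cov (leftField (maurerCartan x (Y x))) x v) := by
  have : IsManifold (𝓡 3) 1 QuaternionSphere := inferInstance
  have h (Z : ∀ x : QuaternionSphere, TangentSpace (𝓡 3) x) (hZ : IsMDiffFieldAt Z x) :=
    IsCovariantDerivativeOn.difference_apply cov.isCovariantDerivativeOnUniv
      (leftConnection 0).isCovariantDerivativeOnUniv (Set.mem_univ x) hZ
  have h1 := h Y hY
  have h2 := h (leftField (maurerCartan x (Y x))) (mdifferentiableAt_leftField _ x)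
  rw [leftField_maurerCartan] at h2
  have h3 := congrArg (maurerCartan x) (DFunLike.congr_fun (h1.symm.trans h2) v)
  simp only [sub_apply, map_sub] at h3
  have h4 := maurerCartan_leftConnection 0 Y x v
  have h5 := maurerCartan_leftConnection 0 (leftField (maurerCartan x (Y x))) x v
  simp only [maurerCartan_leftField, mvfderiv_const] at h5
  simp at h4 h5
  rw [← h4]
  have h6 : leftConnection 0 (leftField (maurerCartan x (Y x))) x v = 0 :=
    maurerCartan_injective x (by rw [map_zero]; exact h5)
  have h7 := h3.trans (congrArg (fun z ↦ _ - maurerCartan x z) h6)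
  rw [map_zero, sub_zero] at h7
  rw [← h7]
  exact (add_sub_cancel _ _).symm

/-- The velocity of a curve in `S³`, translated to the imaginary quaternions. -/
def bodyVelocity (γ : ℝ → QuaternionSphere) (t : ℝ) : EuclideanSpace ℝ (Fin 3) :=
  maurerCartan (γ t) (curveVelocity γ t)

lemma mvfderiv_coe_curveVelocity {γ : ℝ → QuaternionSphere} {t : ℝ}
    (hγ : MDifferentiableAt 𝓘(ℝ) (𝓡 3) γ t) :
    mvfderiv (𝓡 3) ((↑) : QuaternionSphere → ℍ[ℝ]) (γ t) (curveVelocity γ t) =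
      deriv (fun s ↦ (γ s : ℍ[ℝ])) t := by
  have h := (mdifferentiableAt_quaternionSphere_coe (γ t)).hasMFDerivAt.comp t hγ.hasMFDerivAt
  have h2 := h.mfderiv
  rw [mfderiv_eq_fderiv] at h2
  exact (DFunLike.congr_fun h2 (1 : ℝ)).symm

lemma bodyVelocity_eq {γ : ℝ → QuaternionSphere} {t : ℝ}
    (hγ : MDifferentiableAt 𝓘(ℝ) (𝓡 3) γ t) :
    bodyVelocity γ t = imVector (star (γ t : ℍ[ℝ]) * deriv (fun s ↦ (γ s : ℍ[ℝ])) t) := by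
  rw [bodyVelocity, maurerCartan_apply, mvfderiv_coe_curveVelocity hγ]

/-- The Maurer-Cartan form in the coordinates of the preferred chart at `p`. -/
def coordinateMaurerCartan (p : QuaternionSphere) (y : EuclideanSpace ℝ (Fin 3)) :
    EuclideanSpace ℝ (Fin 3) →L[ℝ] EuclideanSpace ℝ (Fin 3) :=
  (imVector.comp (ContinuousLinearMap.mul ℝ ℍ[ℝ]
    (quaternionStar ((extChartAt (𝓡 3) p).symm y : ℍ[ℝ])))).comp
    (fderiv ℝ (((↑) : QuaternionSphere → ℍ[ℝ]) ∘ (extChartAt (𝓡 3) p).symm) y)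

lemma differentiableAt_coordinateMaurerCartan (p : QuaternionSphere) :
    DifferentiableAt ℝ (coordinateMaurerCartan p) (extChartAt (𝓡 3) p p) := by
  have hf := contDiffAt_comp_extChartAt_symm contMDiff_quaternionSphere_coe p
  have hf' : DifferentiableAt ℝ (fderiv ℝ (((↑) : QuaternionSphere → ℍ[ℝ]) ∘
      (extChartAt (𝓡 3) p).symm)) (extChartAt (𝓡 3) p p) :=
    (hf.fderiv_right (m := 1)
      (by rw [one_add_one_eq_two]; exact ENat.LEInfty.out)).differentiableAt (by simp)
  have h1 : DifferentiableAt ℝ (fun y ↦ ContinuousLinearMap.mul ℝ ℍ[ℝ]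
      (quaternionStar ((((↑) : QuaternionSphere → ℍ[ℝ]) ∘ (extChartAt (𝓡 3) p).symm) y)))
      (extChartAt (𝓡 3) p p) :=
    (ContinuousLinearMap.mul ℝ ℍ[ℝ]).differentiableAt.comp _
      (quaternionStar.differentiableAt.comp _ (hf.differentiableAt (by simp)))
  exact ((differentiableAt_const imVector).clm_comp h1).clm_comp hf'

lemma maurerCartan_coordinateField {p x : QuaternionSphere}
    (hx : x ∈ (extChartAt (𝓡 3) p).source) (w : EuclideanSpace ℝ (Fin 3)) :
    maurerCartan x (coordinateField p w x) =
      coordinateMaurerCartan p (extChartAt (𝓡 3) p x) w := by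
  rw [maurerCartan_apply, mvfderiv_coordinateField hx (mdifferentiableAt_quaternionSphere_coe x)]
  simp only [coordinateMaurerCartan, (extChartAt (𝓡 3) p).left_inv hx]
  rfl

lemma coordinateField_self (p : QuaternionSphere) (w : EuclideanSpace ℝ (Fin 3)) :
    coordinateField p w p = w := by
  have : IsManifold (𝓡 3) 1 QuaternionSphere := inferInstance
  have h := (TangentBundle.symmL_trivializationAt (𝕜 := ℝ) (I := 𝓡 3) (mem_chart_source _ p)).trans
    mfderivWithin_range_extChartAt_symm
  exact DFunLike.congr_fun h w

lemma maurerCartan_eq_coordinateMaurerCartan (p : QuaternionSphere) (v : TangentSpace (𝓡 3) p) :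
    maurerCartan p v = coordinateMaurerCartan p (extChartAt (𝓡 3) p p) v := by
  exact (congrArg (maurerCartan p) (coordinateField_self p v).symm).trans
    (maurerCartan_coordinateField (mem_extChartAt_source p) v)

lemma mvfderiv_maurerCartan_coordinateField (p : QuaternionSphere)
    (w : EuclideanSpace ℝ (Fin 3)) (v : TangentSpace (𝓡 3) p) :
    mvfderiv (𝓡 3) (fun x ↦ maurerCartan x (coordinateField p w x)) p v =
      fderiv ℝ (coordinateMaurerCartan p) (extChartAt (𝓡 3) p p) v w := by
  have hd := differentiableAt_coordinateMaurerCartan p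
  rw [(mdifferentiableAt_and_mvfderiv_of_comp_extChartAt_symm
    (hd.clm_apply (differentiableAt_const w)) ?_).2, fderiv_clm_apply hd (by fun_prop)]
  · simp
    rfl
  · filter_upwards [extChartAt_target_mem_nhds (I := 𝓡 3) p] with y hy
    rw [Function.comp_apply, maurerCartan_coordinateField ((extChartAt (𝓡 3) p).map_target hy),
      (extChartAt (𝓡 3) p).right_inv hy]

/-- The chart at `γ t` is kept fixed while `s` varies near `t`, so that the right side can be
differentiated at `t`. -/
lemma bodyVelocity_eventuallyEq {γ : ℝ → QuaternionSphere} {t : ℝ}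
    (hγ : ContMDiffAt 𝓘(ℝ) (𝓡 3) ∞ γ t) :
    bodyVelocity γ =ᶠ[𝓝 t] fun s ↦ coordinateMaurerCartan (γ t) (extChartAt (𝓡 3) (γ t) (γ s))
      (deriv (extChartAt (𝓡 3) (γ t) ∘ γ) s) := by
  have hc : ContDiffAt ℝ ∞ (extChartAt (𝓡 3) (γ t) ∘ γ) t :=
    ((contMDiffAt_extChartAt (n := ∞)).comp t hγ).contDiffAt
  have h1 : ∀ᶠ s in 𝓝 t, ContMDiffAt 𝓘(ℝ) (𝓡 3) 1 γ s :=
    (contMDiffAt_iff_contMDiffAt_nhds (by simp)).1 (hγ.of_le ENat.LEInfty.out)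
  have h2 : ∀ᶠ s in 𝓝 t, ContDiffAt ℝ 1 (extChartAt (𝓡 3) (γ t) ∘ γ) s :=
    (hc.of_le ENat.LEInfty.out).eventually (by simp)
  have h3 : ∀ᶠ s in 𝓝 t, ContDiffAt ℝ 1 (((↑) : QuaternionSphere → ℍ[ℝ]) ∘
      (extChartAt (𝓡 3) (γ t)).symm) ((extChartAt (𝓡 3) (γ t) ∘ γ) s) :=
    hc.continuousAt.eventually
      (((contDiffAt_comp_extChartAt_symm contMDiff_quaternionSphere_coe (γ t)).of_le
        ENat.LEInfty.out).eventually (by simp))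
  have h4 : ∀ᶠ s in 𝓝 t, γ s ∈ (extChartAt (𝓡 3) (γ t)).source :=
    hγ.continuousAt.eventually (extChartAt_source_mem_nhds _)
  filter_upwards [h1, h2, h3, h4, h4.eventually_nhds] with s h1 h2 h3 h4 h5
  have h6 : (fun r ↦ (γ r : ℍ[ℝ])) =ᶠ[𝓝 s] (((↑) : QuaternionSphere → ℍ[ℝ]) ∘
      (extChartAt (𝓡 3) (γ t)).symm) ∘ (extChartAt (𝓡 3) (γ t) ∘ γ) := by
    filter_upwards [h5] with r hr
    simp only [Function.comp_apply, (extChartAt (𝓡 3) (γ t)).left_inv hr]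
  rw [bodyVelocity_eq (h1.mdifferentiableAt (by simp)), h6.deriv_eq,
    fderiv_comp_deriv s (h3.differentiableAt (by simp)) (h2.differentiableAt (by simp))]
  simp only [coordinateMaurerCartan, (extChartAt (𝓡 3) (γ t)).left_inv h4]
  rfl

lemma maurerCartan_cov_coordinateField (cov : CovariantDerivative (𝓡 3)
      (EuclideanSpace ℝ (Fin 3)) (TangentSpace (𝓡 3) : QuaternionSphere → Type _))
    (p : QuaternionSphere) (v : TangentSpace (𝓡 3) p) :
    maurerCartan p (cov (coordinateField (E := EuclideanSpace ℝ (Fin 3)) p v) p v) =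
      fderiv ℝ (coordinateMaurerCartan p) (extChartAt (𝓡 3) p p) v v +
      maurerCartan p (cov (leftField (maurerCartan p v)) p v) := by
  have h := maurerCartan_cov cov (mdifferentiableAt_coordinateField
    (E := EuclideanSpace ℝ (Fin 3)) p v) v
  have h2 : coordinateField (E := EuclideanSpace ℝ (Fin 3)) p v p = v := coordinateField_self p v
  rw [h2] at h
  exact h.trans (congrArg (· + _) (mvfderiv_maurerCartan_coordinateField p v v))

lemma maurerCartan_covariantAcceleration (cov : CovariantDerivative (𝓡 3)
      (EuclideanSpace ℝ (Fin 3)) (TangentSpace (𝓡 3) : QuaternionSphere → Type _))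
    (γ : ℝ → QuaternionSphere) (t : ℝ) :
    maurerCartan (γ t) (covariantAcceleration cov γ t) =
      coordinateMaurerCartan (γ t) (extChartAt (𝓡 3) (γ t) (γ t))
        (deriv (deriv (extChartAt (𝓡 3) (γ t) ∘ γ)) t) +
      (fderiv ℝ (coordinateMaurerCartan (γ t)) (extChartAt (𝓡 3) (γ t) (γ t))
        (curveVelocity γ t) (curveVelocity γ t) +
      maurerCartan (γ t) (cov (leftField (bodyVelocity γ t)) (γ t) (curveVelocity γ t))) := by
  refine (map_add (maurerCartan (γ t)) _ _).trans ?_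
  rw [maurerCartan_cov_coordinateField]
  exact congrArg (· + _) (maurerCartan_eq_coordinateMaurerCartan (γ t) _)

lemma curveVelocity_eq_deriv {γ : ℝ → QuaternionSphere} {t : ℝ}
    (hγ : ContMDiffAt 𝓘(ℝ) (𝓡 3) ∞ γ t) :
    curveVelocity γ t = deriv (extChartAt (𝓡 3) (γ t) ∘ γ) t :=
  maurerCartan_injective (γ t) ((bodyVelocity_eventuallyEq hγ).self_of_nhds.trans
    (maurerCartan_eq_coordinateMaurerCartan (γ t) _).symm)

lemma hasDerivAt_clm_comp_deriv {E F : Type*} [NormedAddCommGroup E] [NormedSpace ℝ E]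
    [NormedAddCommGroup F] [NormedSpace ℝ F] {C : E → E →L[ℝ] F} {c : ℝ → E} {t : ℝ}
    (hc : ContDiffAt ℝ ∞ c t) (hC : DifferentiableAt ℝ C (c t)) :
    HasDerivAt (fun s ↦ C (c s) (deriv c s))
      (C (c t) (deriv (deriv c) t) + fderiv ℝ C (c t) (deriv c t) (deriv c t)) t := by
  have hc1 : HasDerivAt c (deriv c t) t := (hc.differentiableAt (by simp)).hasDerivAt
  have hc2 : HasDerivAt (deriv c) (deriv (deriv c) t) t :=
    (((hc.fderiv_right (m := 1) (by rw [one_add_one_eq_two]; exact ENat.LEInfty.out)).clm_apply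
      contDiffAt_const).differentiableAt (by simp)).hasDerivAt
  exact ((hC.hasFDerivAt.comp_hasDerivAt t hc1).clm_apply hc2).congr_deriv (add_comm _ _)

/-- The covariant acceleration of a curve in `S³`, expressed through its body velocity. -/
lemma hasDerivAt_bodyVelocity (cov : CovariantDerivative (𝓡 3)
      (EuclideanSpace ℝ (Fin 3)) (TangentSpace (𝓡 3) : QuaternionSphere → Type _))
    {γ : ℝ → QuaternionSphere} {t : ℝ} (hγ : ContMDiffAt 𝓘(ℝ) (𝓡 3) ∞ γ t) :
    HasDerivAt (bodyVelocity γ) (maurerCartan (γ t) (covariantAcceleration cov γ t) -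
      maurerCartan (γ t) (cov (leftField (bodyVelocity γ t)) (γ t)
        (leftField (bodyVelocity γ t) (γ t)))) t := by
  have hc : ContDiffAt ℝ ∞ (extChartAt (𝓡 3) (γ t) ∘ γ) t :=
    ((contMDiffAt_extChartAt (n := ∞)).comp t hγ).contDiffAt
  have hmain := (hasDerivAt_clm_comp_deriv hc
    (differentiableAt_coordinateMaurerCartan (γ t))).congr_of_eventuallyEq
      (bodyVelocity_eventuallyEq hγ)
  have h1 : leftField (bodyVelocity γ t) (γ t) = curveVelocity γ t := leftField_maurerCartan _ _
  have h2 := maurerCartan_covariantAcceleration cov γ t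
  rw [h1]
  -- The derivative of `coordinateMaurerCartan` along the curve is the same term that the
  -- constant-coefficient extension contributes to the acceleration.
  rw [h2, curveVelocity_eq_deriv hγ, ← add_assoc, add_sub_cancel_right]
  exact hmain

end Acceleration

/-! ### Solving the Euler equation -/

section EulerEquation

open Filter
open scoped Topology

lemma contDiffOn_of_hasDerivAt {E : Type*} [NormedAddCommGroup E] [NormedSpace ℝ E]
    {F : E → E} (hF : ContDiff ℝ ∞ F) {α : ℝ → E} {J : Set ℝ} (hJ : IsOpen J)
    (hα : ∀ t ∈ J, HasDerivAt α (F (α t)) t) : ContDiffOn ℝ ∞ α J := by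
  rw [contDiffOn_infty]
  intro n
  induction n with
  | zero => exact contDiffOn_zero.2 fun t ht ↦ (hα t ht).continuousAt.continuousWithinAt
  | succ n ih =>
    rw [Nat.cast_succ, contDiffOn_succ_iff_deriv_of_isOpen hJ]
    refine ⟨fun t ht ↦ (hα t ht).differentiableAt.differentiableWithinAt, by simp, ?_⟩
    exact ((hF.of_le (by exact_mod_cast le_top)).comp_contDiffOn ih).congr
      fun t ht ↦ (hα t ht).deriv

lemma inner_mul_imQuaternion (q : ℍ[ℝ]) (u : EuclideanSpace ℝ (Fin 3)) :
    inner ℝ q (q * imQuaternion u) = 0 := by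
  rw [Quaternion.inner_def]
  simp
  ring

/-- A smooth function which coincides with the identity near `0` and takes small values. -/
lemma exists_contDiff_eq_id_abs_lt {ε : ℝ} (hε : 0 < ε) :
    ∃ (ψ : ℝ → ℝ) (δ : ℝ), 0 < δ ∧ δ ≤ ε ∧ ContDiff ℝ ∞ ψ ∧ (∀ t, ψ t ∈ Set.Ioo (-ε) ε) ∧
      ∀ t ∈ Set.Ioo (-δ) δ, ψ t = t := by
  let χ : ContDiffBump (0 : ℝ) := ⟨ε / 4, ε / 2, by linarith, by linarith⟩
  refine ⟨fun t ↦ χ t * t, ε / 4, by linarith, by linarith, χ.contDiff.mul contDiff_id,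
    fun t ↦ ?_, fun t ht ↦ ?_⟩
  · show -ε < χ t * t ∧ χ t * t < ε
    rw [← abs_lt, abs_mul, abs_of_nonneg χ.nonneg]
    rcases lt_or_ge |t| (ε / 2) with h | h
    · have := mul_le_mul_of_nonneg_right (χ.le_one (x := t)) (abs_nonneg t)
      linarith
    · rw [χ.zero_of_le_dist (by simpa [χ] using h), zero_mul]
      exact hε
  · have h1 : χ t = 1 := χ.one_of_mem_closedBall (by
      rw [Metric.mem_closedBall, dist_zero_right, Real.norm_eq_abs]
      exact (abs_lt.2 ht).le)
    show χ t * t = t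
    rw [h1, one_mul]

/-- Local solutions of the Euler equation `u' = -A(u, u)` for the body velocity of a curve. -/
lemma exists_curve_bodyVelocity
    (A : EuclideanSpace ℝ (Fin 3) →L[ℝ] EuclideanSpace ℝ (Fin 3) →L[ℝ] EuclideanSpace ℝ (Fin 3))
    (u₀ : EuclideanSpace ℝ (Fin 3)) :
    ∃ (γ : ℝ → QuaternionSphere) (δ : ℝ), 0 < δ ∧ ContMDiff 𝓘(ℝ) (𝓡 3) ∞ γ ∧
      bodyVelocity γ 0 = u₀ ∧ ∀ t ∈ Set.Ioo (-δ) δ,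
        HasDerivAt (bodyVelocity γ) (-A (bodyVelocity γ t) (bodyVelocity γ t)) t := by
  -- The system `x' = x u`, `u' = -A(u, u)`, posed in the vector space `ℍ[ℝ] × ℝ³` to use the
  -- existence theorem for ordinary differential equations there.
  let F : ℍ[ℝ] × EuclideanSpace ℝ (Fin 3) → ℍ[ℝ] × EuclideanSpace ℝ (Fin 3) :=
    fun p ↦ (p.1 * imQuaternion p.2, -A p.2 p.2)
  have hF : ContDiff ℝ ∞ F :=
    (contDiff_fst.mul (imQuaternion.contDiff.comp contDiff_snd)).prodMk
      ((A.contDiff.comp contDiff_snd).clm_apply contDiff_snd).neg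
  obtain ⟨α, hα0, ε, hε, hα⟩ :=
    ((hF.contDiffAt (x := ((1 : ℍ[ℝ]), u₀))).of_le
      ENat.LEInfty.out).exists_forall_mem_closedBall_exists_eq_forall_mem_Ioo_hasDerivAt₀ 0
  rw [zero_sub, zero_add] at hα
  have hα1 (t) (ht : t ∈ Set.Ioo (-ε) ε) :
      HasDerivAt (fun s ↦ (α s).1) ((α t).1 * imQuaternion (α t).2) t := (hα t ht).fst
  have hα2 (t) (ht : t ∈ Set.Ioo (-ε) ε) :
      HasDerivAt (fun s ↦ (α s).2) (-A (α t).2 (α t).2) t := (hα t ht).snd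
  -- The norm is preserved because `x u` is orthogonal to `x` for imaginary `u`, so the solution
  -- stays on the sphere.
  have hnorm (t) (ht : t ∈ Set.Ioo (-ε) ε) : ‖(α t).1‖ = 1 := by
    have hd (t) (ht : t ∈ Set.Ioo (-ε) ε) :
        HasDerivAt (fun s ↦ inner ℝ (α s).1 (α s).1) (0 : ℝ) t := by
      have := (hα1 t ht).inner ℝ (hα1 t ht)
      rwa [real_inner_comm (α t).1 (_ * _), inner_mul_imQuaternion, add_zero] at this
    have hconst := isOpen_Ioo.is_const_of_deriv_eq_zero isPreconnected_Ioo
      (fun t ht ↦ (hd t ht).differentiableAt.differentiableWithinAt)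
      (fun t ht ↦ (hd t ht).deriv) ht (y := 0) ⟨by linarith, hε⟩
    simp only [hα0, real_inner_self_eq_norm_sq] at hconst
    rw [norm_one] at hconst
    exact (pow_left_inj₀ (norm_nonneg _) zero_le_one two_ne_zero).1 hconst
  -- A curve is a total function on `ℝ`, while the solution is controlled only on `(-ε, ε)`.
  -- Composing with `ψ` keeps the parameter in that interval and changes nothing near `0`.
  obtain ⟨ψ, δ, hδ, hδε, hψ, hψε, hψid⟩ := exists_contDiff_eq_id_abs_lt hε
  have hq : ContDiff ℝ ∞ fun t ↦ (α (ψ t)).1 :=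
    contDiff_fst.comp (contDiffOn_univ.1 ((contDiffOn_of_hasDerivAt hF isOpen_Ioo hα).comp
      hψ.contDiffOn fun t _ ↦ hψε t))
  have hmem (t : ℝ) : (α (ψ t)).1 ∈ Metric.sphere (0 : ℍ[ℝ]) 1 :=
    mem_sphere_zero_iff_norm.2 (hnorm _ (hψε t))
  let γ : ℝ → QuaternionSphere := Set.codRestrict (fun t ↦ (α (ψ t)).1) _ hmem
  have hγ : ContMDiff 𝓘(ℝ) (𝓡 3) ∞ γ := hq.contMDiff.codRestrict_sphere hmem
  have hvel (t) (ht : t ∈ Set.Ioo (-δ) δ) : bodyVelocity γ t = (α t).2 := by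
    have h1 : (fun s ↦ (γ s : ℍ[ℝ])) =ᶠ[𝓝 t] fun s ↦ (α s).1 := by
      filter_upwards [isOpen_Ioo.mem_nhds ht] with s hs
      simp [γ, hψid s hs]
    have h2 := star_mul_self_quaternionSphere (γ t)
    have h3 : (γ t : ℍ[ℝ]) = (α t).1 := h1.self_of_nhds
    rw [bodyVelocity_eq (hγ.mdifferentiableAt (by simp)), h1.deriv_eq,
      (hα1 t ⟨by linarith [ht.1], by linarith [ht.2]⟩).deriv, ← h3, ← mul_assoc, h2,
      one_mul, imVector_imQuaternion]
  refine ⟨γ, δ, hδ, hγ, ?_, fun t ht ↦ ?_⟩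
  · rw [hvel 0 ⟨by linarith, hδ⟩, hα0]
  · rw [hvel t ht]
    refine (hα2 t ⟨by linarith [ht.1], by linarith [ht.2]⟩).congr_of_eventuallyEq ?_
    filter_upwards [isOpen_Ioo.mem_nhds ht] with s hs using hvel s hs

end EulerEquation

/-! ### From equivalent metrics to proportional forms -/

section GeodesicEquivalence

open Filter
open scoped Topology

lemma bodyVelocity_comp {γ : ℝ → QuaternionSphere} {τ : ℝ → ℝ} {t : ℝ}
    (hγ : MDifferentiableAt 𝓘(ℝ) (𝓡 3) γ (τ t)) (hτ : DifferentiableAt ℝ τ t) :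
    bodyVelocity (γ ∘ τ) t = deriv τ t • bodyVelocity γ (τ t) := by
  have h1 : DifferentiableAt ℝ (fun s ↦ (γ s : ℍ[ℝ])) (τ t) :=
    ((mdifferentiableAt_quaternionSphere_coe _).comp (τ t) hγ).differentiableAt
  rw [bodyVelocity_eq hγ, bodyVelocity_eq (hγ.comp t hτ.mdifferentiableAt)]
  have h2 : deriv (fun s ↦ ((γ ∘ τ) s : ℍ[ℝ])) t =
      deriv τ t • deriv (fun s ↦ (γ s : ℍ[ℝ])) (τ t) := deriv.scomp t h1 hτ
  rw [h2, mul_smul_comm, map_smul]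
  rfl

lemma bodyVelocity_congr {γ γ' : ℝ → QuaternionSphere} {t : ℝ} (h : γ =ᶠ[𝓝 t] γ') :
    bodyVelocity γ t = bodyVelocity γ' t := by
  have h1 : (fun v : EuclideanSpace ℝ (Fin 3) ↦ maurerCartan (γ t) v) =
      fun v : EuclideanSpace ℝ (Fin 3) ↦ maurerCartan (γ' t) v := by rw [h.self_of_nhds]
  have h2 := congrArg (fun L : ℝ →L[ℝ] EuclideanSpace ℝ (Fin 3) ↦ L 1)
    (h.mfderiv_eq (I := 𝓘(ℝ)) (I' := 𝓡 3))
  exact (congrFun h1 _).trans (congrArg (fun v : EuclideanSpace ℝ (Fin 3) ↦ maurerCartan (γ' t) v)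
    h2)

namespace PseudoRiemannianMetric

variable {g g' : PseudoRiemannianMetric (EuclideanSpace ℝ (Fin 3)) QuaternionSphere}

lemma formAtOne_injective {u w : EuclideanSpace ℝ (Fin 3)}
    (h : ∀ z, g.formAtOne u z = g.formAtOne w z) : u = w := by
  rw [← sub_eq_zero]
  exact formAtOne_nondegenerate (g := g) _ fun z ↦ by simp [h]

/-- Torsion does not involve the metric, and the compatibility equation is linear in it. -/
lemma IsLeftInvariant.isLeviCivita_of_isConstantMultiple (hg : g.IsLeftInvariant)
    (hg' : g'.IsLeftInvariant) (h : g.IsConstantMultiple g') {cov} (hcov : g.IsLeviCivita cov) :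
    g'.IsLeviCivita cov := by
  obtain ⟨c, -, hc⟩ := h
  refine ⟨hcov.1, fun Y Z x hY hZ v ↦ (hg'.mvfderiv_val hY hZ v).trans ?_⟩
  have h1 := (hg.mvfderiv_val hY hZ v).symm.trans (hcov.2 Y Z x hY hZ v)
  have hc1 (u w) : g'.formAtOne u w = c * g.formAtOne u w := hc 1 _ _
  rw [hc1, hc1, hc, hc, ← mul_add, ← mul_add, h1]

lemma IsLeftInvariant.isConstantMultiple_of_quadratic (hg : g.IsLeftInvariant)
    (hg' : g'.IsLeftInvariant) (q q' : EuclideanSpace ℝ (Fin 3) → EuclideanSpace ℝ (Fin 3))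
    (hq : ∀ u w, g.formAtOne (q u) w = g.formAtOne u (imBracket w u))
    (hq' : ∀ u w, g'.formAtOne (q' u) w = g'.formAtOne u (imBracket w u))
    (hqq : ∀ u, ∃ r : ℝ, q u = q' u + r • u) : g.IsConstantMultiple g' := by
  obtain ⟨c, hc, h⟩ := exists_eq_smul_of_imBracket_quadratic_parallel g.formAtOne g'.formAtOne
    formAtOne_symm formAtOne_nondegenerate formAtOne_nondegenerate q q' hq hq' hqq
  exact ⟨c, hc, fun x v w ↦ by rw [hg.val_eq, hg'.val_eq, h]⟩

lemma IsLeftInvariant.isConstantMultiple_of_affinelyEquivalent (hg : g.IsLeftInvariant)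
    (hg' : g'.IsLeftInvariant) (h : g.AffinelyEquivalent g') : g.IsConstantMultiple g' := by
  obtain ⟨cov, hcov, hcov'⟩ := h
  exact hg.isConstantMultiple_of_quadratic hg'
    (fun u ↦ maurerCartan 1 (cov (leftField u) 1 (leftField u 1)))
    (fun u ↦ maurerCartan 1 (cov (leftField u) 1 (leftField u 1)))
    (hg.formAtOne_cov_leftField hcov 1) (hg'.formAtOne_cov_leftField hcov' 1)
    fun u ↦ ⟨0, by simp⟩

/-- The covariant acceleration for a left-invariant metric, through the Euler equation. -/
lemma IsLeftInvariant.hasDerivAt_bodyVelocity (hg : g.IsLeftInvariant) {cov}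
    (hcov : g.IsLeviCivita cov)
    {q : EuclideanSpace ℝ (Fin 3) → EuclideanSpace ℝ (Fin 3)}
    (hq : ∀ u w, g.formAtOne (q u) w = g.formAtOne u (imBracket w u))
    {γ : ℝ → QuaternionSphere} {t : ℝ} (hγ : ContMDiffAt 𝓘(ℝ) (𝓡 3) ∞ γ t) :
    HasDerivAt (bodyVelocity γ) (maurerCartan (γ t) (covariantAcceleration cov γ t) -
      q (bodyVelocity γ t)) t := by
  have h := _root_.hasDerivAt_bodyVelocity cov hγ
  have h2 : maurerCartan (γ t) (cov (leftField (bodyVelocity γ t)) (γ t)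
      (leftField (bodyVelocity γ t) (γ t))) = q (bodyVelocity γ t) :=
    formAtOne_injective (g := g) fun w ↦ by rw [hg.formAtOne_cov_leftField hcov, hq]
  rwa [h2] at h

lemma IsGeodesicOn.hasDerivAt_bodyVelocity (hg : g.IsLeftInvariant)
    {q : EuclideanSpace ℝ (Fin 3) → EuclideanSpace ℝ (Fin 3)}
    (hq : ∀ u w, g.formAtOne (q u) w = g.formAtOne u (imBracket w u))
    {γ : ℝ → QuaternionSphere} {J : Set ℝ} (hγ : g.IsGeodesicOn γ J) {t : ℝ} (ht : t ∈ J) :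
    HasDerivAt (bodyVelocity γ) (-q (bodyVelocity γ t)) t := by
  obtain ⟨hJ, -, hs, cov, hcov, hacc⟩ := hγ
  have h := hg.hasDerivAt_bodyVelocity hcov hq (hs.contMDiffAt (hJ.mem_nhds ht))
  rwa [hacc t ht, map_zero, zero_sub] at h

lemma IsLeftInvariant.exists_isGeodesicOn (hg : g.IsLeftInvariant)
    (u₀ : EuclideanSpace ℝ (Fin 3)) :
    ∃ (γ : ℝ → QuaternionSphere) (J : Set ℝ), g.IsGeodesicOn γ J ∧ 0 ∈ J ∧
      bodyVelocity γ 0 = u₀ := by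
  obtain ⟨A, hcov, hA⟩ := hg.exists_isLeviCivita
  obtain ⟨γ, δ, hδ, hγ, h0, hd⟩ := exists_curve_bodyVelocity A u₀
  refine ⟨γ, Set.Ioo (-δ) δ, ⟨isOpen_Ioo, Set.ordConnected_Ioo, hγ.contMDiffOn, _, hcov,
    fun t ht ↦ ?_⟩, ⟨by linarith, hδ⟩, h0⟩
  have h := (hg.hasDerivAt_bodyVelocity hcov (q := fun u ↦ A u u) hA (hγ t)).unique (hd t ht)
  refine maurerCartan_injective (γ t) ?_
  rw [map_zero]
  rwa [sub_eq_neg_self] at h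

lemma IsLeftInvariant.isConstantMultiple_of_geodesicallyEquivalent (hg : g.IsLeftInvariant)
    (hg' : g'.IsLeftInvariant) (h : g.GeodesicallyEquivalent g') : g.IsConstantMultiple g' := by
  obtain ⟨A, -, hA⟩ := hg.exists_isLeviCivita
  obtain ⟨A', -, hA'⟩ := hg'.exists_isLeviCivita
  refine hg.isConstantMultiple_of_quadratic hg' (fun u ↦ A u u) (fun u ↦ A' u u) hA hA' fun u ↦ ?_
  obtain ⟨γ, J, hγ, h0, hu⟩ := hg.exists_isGeodesicOn u
  obtain ⟨γ', J', τ, hγ', hτ, hτ0, hJ, hγγ'⟩ := h γ J hγ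
  have hJo := hγ.1
  have hτJ (t) (ht : t ∈ J) : τ t ∈ J' := hJ ▸ Set.mem_image_of_mem τ ht
  have hvel (t) (ht : t ∈ J) : bodyVelocity γ t = deriv τ t • bodyVelocity γ' (τ t) := by
    have h1 : γ =ᶠ[𝓝 t] γ' ∘ τ := by
      filter_upwards [hJo.mem_nhds ht] with s hs using hγγ' s hs
    rw [bodyVelocity_congr h1]
    exact bodyVelocity_comp ((hγ'.2.2.1.contMDiffAt (hγ'.1.mem_nhds (hτJ t ht))).mdifferentiableAt
      (by simp)) ((hτ.contDiffAt (hJo.mem_nhds ht)).differentiableAt (by simp))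
  have hd := hγ.hasDerivAt_bodyVelocity hg (q := fun u ↦ A u u) hA h0
  have hd' := hγ'.hasDerivAt_bodyVelocity hg' (q := fun u ↦ A' u u) hA' (hτJ 0 h0)
  have hτ1 : HasDerivAt τ (deriv τ 0) 0 :=
    ((hτ.contDiffAt (hJo.mem_nhds h0)).differentiableAt (by simp)).hasDerivAt
  have hτ2 : HasDerivAt (deriv τ) (deriv (deriv τ) 0) 0 :=
    (((hτ.deriv_of_isOpen hJo (m := 1) (by rw [one_add_one_eq_two]; exact ENat.LEInfty.out)).contDiffAt
      (hJo.mem_nhds h0)).differentiableAt (by simp)).hasDerivAt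
  -- The derivative of `τ' • v(τ)` at `0`, `v` being the body velocity of `γ'`; by Euler's equation
  -- for `g'` it is `τ'' v - τ' ^ 2 q'(v)`.
  have hd2 := (hτ2.smul (hd'.scomp 0 hτ1)).congr_of_eventuallyEq (f₁ := bodyVelocity γ) (by
    filter_upwards [hJo.mem_nhds h0] with s hs using hvel s hs)
  have heq := hd.unique hd2
  have hv := hvel 0 h0
  have hne := hτ0 0 h0
  rw [hu] at heq hv
  have hv' : bodyVelocity γ' (τ 0) = (deriv τ 0)⁻¹ • u := by
    rw [hv, smul_smul, inv_mul_cancel₀ hne, one_smul]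
  -- With `v = u / τ'` and `q'` homogeneous of degree two, the two derivatives give `-q(u) = (τ'' /
  -- τ') u - q'(u)`, so `r = -τ'' / τ'`.
  refine ⟨-(deriv (deriv τ) 0 * (deriv τ 0)⁻¹), ?_⟩
  simp only [Function.comp_apply, hv', map_smul, smul_apply, smul_neg, smul_smul] at heq
  have h1 : deriv τ 0 * (deriv τ 0 * ((deriv τ 0)⁻¹ * (deriv τ 0)⁻¹)) = 1 := by field_simp
  rw [h1, one_smul] at heq
  rw [← neg_neg (A u u), heq, neg_smul]
  abel

end PseudoRiemannianMetric

end GeodesicEquivalence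

end

/-- Every left-invariant pseudo-Riemannian metric (of any signature) on the Lie group `S³` of unit
quaternions is invariantly rigid, and the left-invariant metrics geodesically equivalent to it are
exactly its nonzero constant multiples. -/
theorem theorem3
    (g : PseudoRiemannianMetric (EuclideanSpace ℝ (Fin 3)) QuaternionSphere)
    (hg : g.IsLeftInvariant) :
    g.IsInvariantlyRigid ∧
      ∀ g' : PseudoRiemannianMetric (EuclideanSpace ℝ (Fin 3)) QuaternionSphere,
        g'.IsLeftInvariant → (g.GeodesicallyEquivalent g' ↔ g.IsConstantMultiple g') := by
  refine ⟨fun g' hg' ↦ ⟨hg.isConstantMultiple_of_affinelyEquivalent hg', fun h ↦ ?_⟩,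
    fun g' hg' ↦ ⟨hg.isConstantMultiple_of_geodesicallyEquivalent hg', fun h γ J hγ ↦ ?_⟩⟩
  · obtain ⟨A, hA, -⟩ := hg.exists_isLeviCivita
    exact ⟨_, hA, hg.isLeviCivita_of_isConstantMultiple hg' h hA⟩
  · obtain ⟨hJ, hJ', hs, cov, hcov, hacc⟩ := hγ
    exact ⟨γ, J, id, ⟨hJ, hJ', hs, cov, hg.isLeviCivita_of_isConstantMultiple hg' h hcov, hacc⟩,
      contDiffOn_id, by simp, by simp, by simp⟩
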